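/- Let $\mathcal S$ be a ribbon category with braiding $c$, twist $\theta$, duals $U^\vee$ (evaluation $\mathrm{ev}_U:U^\vee\otimes U\to\mathbf 1$, coevaluation $\mathrm{coev}_U:\mathbf 1\to U\otimes U^\vee$), and natural monoidal isomorphism $\delta_U:U\to U^{\vee\vee}$ given by $\delta_U=u_U\circ\theta_U$ with $u_U=(\mathrm{ev}_U\circ c_{U,U^\vee}\otimes\mathrm{id})\circ(\mathrm{id}_U\otimes\mathrm{coev}_{U^\vee})$. (Associativity and unit isomorphisms of $\mathcal S$ are suppressed below.) Let $H=(H,\mu,\eta,\Delta,\varepsilon,S)$ be a Hopf algebra in $\mathcal S$ with invertible antipode $S$. A morphism $x:\mathbf 1\to A$ to an algebra $A$ has a multiplicative inverse $x^{-1}:\mathbf 1\to A$ if $\mu_A\circ(x\otimes x^{-1})=\eta_A=\mu_A\circ(x^{-1}\otimes x)$. The product of $H\otimes H$ is $(\mu\otimes\mu)\circ(\mathrm{id}\otimes c_{H,H}\otimes\mathrm{id})$. For $x:\mathbf 1\to H$ let $M_x=\mu\circ(\mathrm{id}\otimes x)$, ${}_xM=\mu\circ(x\otimes\mathrm{id})$,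 and $\mathrm{Ad}_x={}_xM\circ M_{x^{-1}}$. Let $\mathcal C=\mathcal C_0\sqcup\mathcal C_1$ be the disjoint union of the category $\mathcal C_0=\mathrm{Rep}_{\mathcal S}(H)$ of left $H$-modules in $\mathcal S$ and of $\mathcal C_1=\mathcal S$. Define $\otimes_{\mathcal C}$ as follows. For $A,B\in\mathcal C_0$ it is the tensor product of $H$-modules, with $H$ acting through $\Delta$ and the braiding $c_{H,A}$; if exactly one of $A,B$ lies in $\mathcal C_1$, it is the tensor product in $\mathcal S$ of the underlying objects, regarded as an object of $\mathcal C_1$; for $A,B\in\mathcal C_1$ it is the free module $H\otimes A\otimes B\in\mathcal C_0$. On morphisms it is $f\otimes g$ in the first two cases and $\mathrm{id}_H\otimes f\otimes g$ in the last one. Let $\gamma,\delta:\mathbf 1\to H\otimes H$ and $\varphi:H\to H$ be morphisms such that $\gamma$ and $(S^{-1}\otimes\mathrm{id})\circ\delta$ have multiplicative inverses in $H\otimes H$ and $\varphi$ is invertible. Define $\alpha_{A,B,C}:A\otimes_{\mathcal C}(B\otimes_{\mathcal C}C)\to(A\otimes_{\mathcal C}B)\otimes_{\mathcal C}C$ as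 follows, where superscripts denote the degree of an object. Sweedler notation is used, $\gamma=\gamma_1\otimes\gamma_2$, $\delta=\delta_1\otimes\delta_2$, and the tensor factors are permuted by the braidings indicated. * $\alpha_{A^0,B^0,C^0}$, $\alpha_{A^0,B^0,C^1}$ and $\alpha_{A^1,B^0,C^0}$ are identities. * $\alpha_{A^0,B^1,C^0}=(\mathrm{id}_A\otimes c_{C,B})\circ\big[\rho^{H\otimes H}_{A\otimes C}\circ(\gamma\otimes\mathrm{id}_{A\otimes C})\otimes\mathrm{id}_B\big]\circ(\mathrm{id}_A\otimes c_{C,B}^{-1})$, where $\rho^{H\otimes H}_{A\otimes C}=(\rho_A\otimes\rho_C)\circ(\mathrm{id}\otimes c_{H,A}\otimes\mathrm{id})$. * $\alpha_{A^0,B^1,C^1}:a\otimes h\otimes b\otimes c\mapsto h_2\otimes S^{-1}(h_1)a\otimes b\otimes c$, where first $h_1$ and then $h_2$ are moved to the left past $A$ by $c_{H,A}^{-1}$. That is, it is the inverse of $h\otimes a\otimes b\otimes c\mapsto h_1a\otimes h_2\otimes b\otimes c$, where $h_2$ is moved past $A$ by $c_{H,A}$. * $\alpha_{A^1,B^0,C^1}:h\otimes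 a\otimes b\otimes c\mapsto h\delta_1\otimes a\otimes\delta_2b\otimes c$, where $\delta_2$ is moved past $A$ by $c_{H,A}$. * $\alpha_{A^1,B^1,C^0}:h\otimes a\otimes b\otimes c\mapsto h_1\otimes a\otimes b\otimes h_2c$, where $h_2$ is moved past $A\otimes B$ by $c_{H,A\otimes B}$. * $\alpha_{A^1,B^1,C^1}=\big(c_{H,A}^{-1}\circ(\mathrm{id}_A\otimes\varphi)\big)\otimes\mathrm{id}_B\otimes\mathrm{id}_C$. Suppose that the pentagon $$\alpha_{A\otimes_{\mathcal C}B,C,D}\circ\alpha_{A,B,C\otimes_{\mathcal C}D}=(\alpha_{A,B,C}\otimes_{\mathcal C}\mathrm{id}_D)\circ\alpha_{A,B\otimes_{\mathcal C}C,D}\circ(\mathrm{id}_A\otimes_{\mathcal C}\alpha_{B,C,D})$$ commutes for all $A,B,C,D\in\mathcal C$ (16 cases, according to the degrees of the objects). Put $$\Gamma=(\mathrm{ev}_H\otimes\mathrm{id}_H)\circ\big(\mathrm{id}_{H^\vee}\otimes((\mathrm{id}\otimes S)\circ\gamma)\big):H^\vee\to H,\qquad \lambda=\varepsilon\circ\varphi:H\to\mathbf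 1 .$$ Then there is a unique $g:\mathbf 1\to H$ with $(\mathrm{id}_H\otimes\lambda)\circ\Delta=g\circ\lambda$. It has a multiplicative inverse and is group-like ($\Delta\circ g=g\otimes g$, $\varepsilon\circ g=\mathrm{id}_{\mathbf 1}$). Moreover: (i) $\gamma,\delta,\varphi$ are determined by $\Gamma,\lambda$ through $$\gamma=(S^{-1}\otimes\Gamma)\circ\mathrm{coev}_H,\qquad \delta=(S\otimes(M_g\circ\Gamma))\circ\mathrm{coev}_H,$$ $$\varphi=(\mathrm{id}_H\otimes(\lambda\circ\mu))\circ\big(((\mathrm{id}_H\otimes\Gamma)\circ\mathrm{coev}_H)\otimes\mathrm{id}_H\big).$$ (ii) The pair $(\Gamma,\lambda)$ satisfies: a) $\Gamma$ is an isomorphism of Hopf algebras $H^\vee\to H$. Here the structure maps of $H^\vee$ are the duals $\Delta^\vee,\varepsilon^\vee,\mu^\vee,\eta^\vee,S^\vee$ (product, unit, coproduct, counit, antipode), with $(H\otimes H)^\vee=H^\vee\otimes H^\vee$ by the nested evaluation $\mathrm{ev}_H\circ(\mathrm{id}_{H^\vee}\otimes\mathrm{ev}_H\otimes\mathrm{id}_H)$.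 b) $\lambda$ is a right cointegral, i.e. $(\lambda\otimes\mathrm{id}_H)\circ\Delta=\eta\circ\lambda$, and $(\lambda\otimes\lambda)\circ(\mathrm{id}_H\otimes\Gamma)\circ\mathrm{coev}_H=\mathrm{id}_{\mathbf 1}$. c) $\Gamma^\vee=\delta_H\circ\theta_H^{-1}\circ S^2\circ\mathrm{Ad}_{g^{-1}}\circ\Gamma$ as morphisms $H^\vee\to H^{\vee\vee}$ (where $\delta_H$ is the isomorphism $H\to H^{\vee\vee}$). -/

import Mathlib

open CategoryTheory MonoidalCategory
open scoped MonObj ComonObj HopfObj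

set_option linter.unusedSectionVars false

universe v u

namespace HopfExt

/-! ### Ribbon categories -/

/-- The data and axioms of a twist on a braided category with duals `Xᘁ`, with evaluation
`Xᘁ ⊗ X ⟶ 𝟙` and coevaluation `𝟙 ⟶ X ⊗ Xᘁ`; a category with this structure is a ribbon category. -/
class RibbonCategory (S : Type u) [Category.{v} S] [MonoidalCategory S] [BraidedCategory S]
    [RightRigidCategory S] where
  /-- The twist `θ`, a natural automorphism of the identity functor. -/
  twist : 𝟭 S ≅ 𝟭 S
  twist_tensor (X Y : S) : twist.hom.app (X ⊗ Y) =
    (β_ X Y).hom ≫ (β_ Y X).hom ≫ (twist.hom.app X ⊗ₘ twist.hom.app Y)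
  twist_dual (X : S) : twist.hom.app (Xᘁ) = (twist.hom.app X)ᘁ

section DoubleDual

variable {S : Type u} [Category.{v} S] [MonoidalCategory S] [BraidedCategory S]
  [RightRigidCategory S]

/-- The dual `Xᘁ` of an object. -/
abbrev dual (X : S) : S := HasRightDual.rightDual X

/-- The Drinfeld isomorphism
`X ⟶ X ⊗ (Xᘁ ⊗ Xᘁᘁ) ⟶ (X ⊗ Xᘁ) ⊗ Xᘁᘁ ⟶ (Xᘁ ⊗ X) ⊗ Xᘁᘁ ⟶ Xᘁᘁ`, which is natural but in general
not monoidal. -/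
noncomputable def drinfeld (X : S) : X ⟶ dual (dual X) :=
  (ρ_ X).inv ≫ X ◁ η_ (dual X) (dual (dual X)) ≫ (α_ X (dual X) (dual (dual X))).inv ≫
    (β_ X (dual X)).hom ▷ dual (dual X) ≫ ε_ X (dual X) ▷ dual (dual X) ≫ (λ_ _).hom

/-- The natural monoidal isomorphism `X ≅ Xᘁᘁ` (the pivotal structure) of a ribbon category: the
twist followed by the Drinfeld isomorphism. -/
noncomputable def toDoubleDual [RibbonCategory S] (X : S) : X ⟶ dual (dual X) :=
  (RibbonCategory.twist (S := S)).hom.app X ≫ drinfeld X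

end DoubleDual

section Modules

variable {S : Type u} [Category.{v} S] [MonoidalCategory S] [BraidedCategory S]
variable {H : S} [HopfObj H] {X Y Z : S}

/-! ### Modules over a Hopf algebra `H` in `S` -/

/-- The action of `H` on a module. -/
def act (M : Mod S H) : H ⊗ M.X ⟶ M.X := ModObj.smul (M := H) (X := M.X)

lemma one_act (M : Mod S H) : η[H] ▷ M.X ≫ act M = (λ_ M.X).hom :=
  ModObj.one_smul_self H M.X

lemma mul_act (M : Mod S H) :
    μ[H] ▷ M.X ≫ act M = (α_ H H M.X).hom ≫ H ◁ act M ≫ act M :=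
  ModObj.mul_smul_self H M.X

lemma act_hom {M N : Mod S H} (f : M ⟶ N) : act M ≫ f.hom = H ◁ f.hom ≫ act N :=
  IsModHom.smul_hom (A := H) (f := f.hom)

/-- The module with underlying object `X` and action `a`. -/
abbrev mkMod (X : S) (a : H ⊗ X ⟶ X) (h₁ : η[H] ▷ X ≫ a = (λ_ X).hom)
    (h₂ : μ[H] ▷ X ≫ a = (α_ H H X).hom ≫ H ◁ a ≫ a) : Mod S H where
  X := X
  mod := { smul := a, one_smul := h₁, mul_smul := h₂ }

/-- A morphism of `S` commuting with the actions, as a morphism of modules. -/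
def mkHom {M N : Mod S H} (f : M.X ⟶ N.X) (h : act M ≫ f = H ◁ f ≫ act N) : M ⟶ N :=
  Mod.Hom.mk' f h

/-- The action of `H ⊗ H` on the tensor product of two modules, by means of the braiding of the second
factor `H` with `X`. -/
def pairAct (a : H ⊗ X ⟶ X) (b : H ⊗ Y ⟶ Y) : (H ⊗ H) ⊗ (X ⊗ Y) ⟶ X ⊗ Y :=
  tensorμ H H X Y ≫ (a ⊗ₘ b)

/-- The action of `H` on the tensor product of two modules, through the coproduct. -/
def diagAct (a : H ⊗ X ⟶ X) (b : H ⊗ Y ⟶ Y) : H ⊗ (X ⊗ Y) ⟶ X ⊗ Y :=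
  Δ[H] ▷ (X ⊗ Y) ≫ pairAct a b

/-- The action of `H` on `H ⊗ X` by left multiplication. -/
def freeAct (H : S) [HopfObj H] (X : S) : H ⊗ (H ⊗ X) ⟶ H ⊗ X :=
  (α_ H H X).inv ≫ μ[H] ▷ X

lemma one_diagAct (M N : Mod S H) :
    η[H] ▷ (M.X ⊗ N.X) ≫ diagAct (act M) (act N) = (λ_ (M.X ⊗ N.X)).hom := by
  rw [diagAct, ← comp_whiskerRight_assoc, BimonObj.one_comul]
  simp only [pairAct, MonObj.tensorObj.one_def, comp_whiskerRight_assoc]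
  slice_lhs 2 3 => rw [tensorμ_natural_left]
  slice_lhs 3 4 => rw [tensorHom_comp_tensorHom, one_act, one_act]
  exact (tensor_left_unitality M.X N.X).symm

lemma mul_pairAct (M N : Mod S H) :
    μ[H ⊗ H] ▷ (M.X ⊗ N.X) ≫ pairAct (act M) (act N) =
      (α_ (H ⊗ H) (H ⊗ H) (M.X ⊗ N.X)).hom ≫ (H ⊗ H) ◁ pairAct (act M) (act N) ≫
        pairAct (act M) (act N) := by
  simp only [pairAct, MonObj.tensorObj.mul_def, comp_whiskerRight_assoc, whiskerLeft_comp_assoc]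
  slice_lhs 2 3 => rw [tensorμ_natural_left]
  slice_lhs 3 4 => rw [tensorHom_comp_tensorHom, mul_act, mul_act, ← tensorHom_comp_tensorHom,
    ← tensorHom_comp_tensorHom]
  slice_lhs 1 3 => rw [tensor_associativity]
  slice_lhs 3 4 => rw [← tensorμ_natural_right]
  simp

lemma mul_diagAct (M N : Mod S H) :
    μ[H] ▷ (M.X ⊗ N.X) ≫ diagAct (act M) (act N) =
      (α_ H H (M.X ⊗ N.X)).hom ≫ H ◁ diagAct (act M) (act N) ≫ diagAct (act M) (act N) := by
  have h : μ[H] ≫ Δ[H] = (Δ[H] ⊗ₘ Δ[H]) ≫ μ[H ⊗ H] := by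
    rw [BimonObj.mul_comul, MonObj.tensorObj.mul_def]
  rw [diagAct, ← comp_whiskerRight_assoc, h, comp_whiskerRight_assoc, mul_pairAct,
    whiskerLeft_comp_assoc, whisker_exchange_assoc, tensorHom_def', comp_whiskerRight_assoc]
  simp

lemma one_freeAct (X : S) : η[H] ▷ (H ⊗ X) ≫ freeAct H X = (λ_ (H ⊗ X)).hom := by
  rw [freeAct, associator_inv_naturality_left_assoc, ← comp_whiskerRight, MonObj.one_mul]
  simp

lemma mul_freeAct (X : S) : μ[H] ▷ (H ⊗ X) ≫ freeAct H X =
    (α_ H H (H ⊗ X)).hom ≫ H ◁ freeAct H X ≫ freeAct H X := by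
  rw [freeAct, associator_inv_naturality_left_assoc, ← comp_whiskerRight, MonObj.mul_assoc]
  simp

/-- The tensor product of two modules. -/
abbrev tensorMod (M N : Mod S H) : Mod S H :=
  mkMod (M.X ⊗ N.X) (diagAct (act M) (act N)) (one_diagAct M N) (mul_diagAct M N)

/-- The free module `H ⊗ X`. -/
abbrev freeMod (H : S) [HopfObj H] (X : S) : Mod S H :=
  mkMod (H ⊗ X) (freeAct H X) (one_freeAct X) (mul_freeAct X)

lemma freeAct_lift (M : Mod S H) (f : X ⟶ M.X) :
    freeAct H X ≫ H ◁ f ≫ act M = H ◁ (H ◁ f ≫ act M) ≫ act M := by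
  rw [freeAct, Category.assoc, ← whisker_exchange_assoc, mul_act]
  simp

lemma freeAct_map {X' : S} (f : X ⟶ X') : freeAct H X ≫ H ◁ f = H ◁ H ◁ f ≫ freeAct H X' := by
  rw [freeAct, freeAct, Category.assoc, ← whisker_exchange]
  simp

lemma diagAct_map {X' Y' : S} {a : H ⊗ X ⟶ X} {b : H ⊗ Y ⟶ Y} {a' : H ⊗ X' ⟶ X'}
    {b' : H ⊗ Y' ⟶ Y'} {f : X ⟶ X'} {g : Y ⟶ Y'} (hf : a ≫ f = H ◁ f ≫ a')
    (hg : b ≫ g = H ◁ g ≫ b') :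
    diagAct a b ≫ (f ⊗ₘ g) = H ◁ (f ⊗ₘ g) ≫ diagAct a' b' := by
  rw [diagAct, diagAct, whisker_exchange_assoc, pairAct, pairAct, Category.assoc,
    Category.assoc, tensorHom_comp_tensorHom, hf, hg, ← tensorHom_comp_tensorHom,
    tensorμ_natural_right_assoc]

lemma comp_tensorHom_left {X' X'' Y' : S} (f : X ⟶ X') (g : X' ⟶ X'') (c : Y ⟶ Y') :
    (f ≫ g) ⊗ₘ c = f ▷ Y ≫ (g ⊗ₘ c) := by
  simp [MonoidalCategory.tensorHom_def]

lemma comp_tensorHom_right {X' Y' Y'' : S} (c : X ⟶ X') (f : Y ⟶ Y') (g : Y' ⟶ Y'') :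
    c ⊗ₘ (f ≫ g) = X ◁ f ≫ (c ⊗ₘ g) := by
  simp [MonoidalCategory.tensorHom_def']

lemma diagAct_assoc (a : H ⊗ X ⟶ X) (b : H ⊗ Y ⟶ Y) (c : H ⊗ Z ⟶ Z) :
    diagAct (diagAct a b) c ≫ (α_ X Y Z).hom =
      H ◁ (α_ X Y Z).hom ≫ diagAct a (diagAct b c) := by
  have e : diagAct (diagAct a b) c = (Δ[H] ≫ Δ[H] ▷ H) ▷ ((X ⊗ Y) ⊗ Z) ≫
      tensorμ (H ⊗ H) H (X ⊗ Y) Z ≫ tensorμ H H X Y ▷ (H ⊗ Z) ≫ ((a ⊗ₘ b) ⊗ₘ c) := by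
    have := tensorμ_natural_left Δ[H] (𝟙 H) (X ⊗ Y) Z
    simp only [tensorHom_id, id_whiskerRight] at this
    simp only [diagAct, pairAct, comp_whiskerRight, Category.assoc, reassoc_of% this,
      comp_tensorHom_left]
  have e' : diagAct a (diagAct b c) = (Δ[H] ≫ H ◁ Δ[H]) ▷ (X ⊗ (Y ⊗ Z)) ≫
      tensorμ H (H ⊗ H) X (Y ⊗ Z) ≫ (H ⊗ X) ◁ tensorμ H H Y Z ≫ (a ⊗ₘ (b ⊗ₘ c)) := by
    have := tensorμ_natural_left (𝟙 H) Δ[H] X (Y ⊗ Z)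
    simp only [id_tensorHom, id_whiskerRight] at this
    simp only [diagAct, pairAct, comp_whiskerRight, Category.assoc, reassoc_of% this,
      comp_tensorHom_right]
  have h : (Δ[H] ≫ H ◁ Δ[H]) ▷ (X ⊗ (Y ⊗ Z)) =
      (Δ[H] ≫ Δ[H] ▷ H) ▷ (X ⊗ (Y ⊗ Z)) ≫ (α_ H H H).hom ▷ (X ⊗ (Y ⊗ Z)) := by
    rw [← comp_whiskerRight, ComonObj.comul_assoc, Category.assoc]
  rw [e, e', h]
  simp only [Category.assoc]
  rw [associator_naturality, associator_monoidal_assoc, MonoidalCategory.tensorHom_def',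
    Category.assoc, whisker_exchange_assoc, whisker_exchange_assoc, whisker_exchange_assoc]

lemma inv_antipode_left (H : S) [HopfObj H] [IsIso 𝒮[H]] :
    Δ[H] ≫ (β_ H H).inv ≫ inv 𝒮[H] ▷ H ≫ μ[H] = ε[H] ≫ η[H] := by
  rw [← cancel_mono 𝒮[H]]
  simp only [Category.assoc, HopfObj.one_antipode, HopfObj.mul_antipode]
  rw [← HopfObj.antipode_left]
  simp [MonoidalCategory.tensorHom_def]

lemma inv_antipode_right (H : S) [HopfObj H] [IsIso 𝒮[H]] :
    Δ[H] ≫ (β_ H H).inv ≫ H ◁ inv 𝒮[H] ≫ μ[H] = ε[H] ≫ η[H] := by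
  rw [← cancel_mono 𝒮[H]]
  simp only [Category.assoc, HopfObj.one_antipode, HopfObj.mul_antipode]
  rw [← HopfObj.antipode_right]
  simp [MonoidalCategory.tensorHom_def']

/-- `h ⊗ m ↦ h₁ m ⊗ h₂`, by means of the braiding. -/
def fromFree (a : H ⊗ X ⟶ X) : H ⊗ X ⟶ X ⊗ H :=
  Δ[H] ▷ X ≫ (α_ H H X).hom ≫ H ◁ (β_ H X).hom ≫ (α_ H X H).inv ≫ a ▷ H

/-- `m ⊗ h ↦ h₂ ⊗ S⁻¹(h₁) m`, by means of the inverse braiding; an inverse of `fromFree`. -/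
noncomputable def toFree [IsIso 𝒮[H]] (a : H ⊗ X ⟶ X) : X ⊗ H ⟶ H ⊗ X :=
  X ◁ Δ[H] ≫ (α_ X H H).inv ≫ ((β_ H X).inv ≫ inv 𝒮[H] ▷ X ≫ a) ▷ H ≫ (β_ H X).inv

/-- `(r ⊗ id) ∘ (id ⊗ Δ)` -/
def coTwist (r : X ⊗ H ⟶ X) : X ⊗ H ⟶ X ⊗ H := X ◁ Δ[H] ≫ (α_ X H H).inv ≫ r ▷ H

lemma coTwist_comp (r r' : X ⊗ H ⟶ X) : coTwist r ≫ coTwist r' =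
    coTwist (X ◁ Δ[H] ≫ (α_ X H H).inv ≫ r ▷ H ≫ r') := by
  have h : X ◁ Δ[H] ≫ X ◁ H ◁ Δ[H] = X ◁ Δ[H] ≫ X ◁ Δ[H] ▷ H ≫ X ◁ (α_ H H H).hom := by
    simp only [← whiskerLeft_comp, ComonObj.comul_assoc]
  simp only [coTwist, Category.assoc, comp_whiskerRight]
  rw [← whisker_exchange_assoc]
  simp [reassoc_of% h]

lemma fromFree_eq (a : H ⊗ X ⟶ X) :
    (β_ H X).inv ≫ fromFree a = coTwist ((β_ H X).inv ≫ a) := by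
  rw [fromFree, coTwist, Iso.inv_comp_eq, ← BraidedCategory.braiding_naturality_left_assoc]
  simp [BraidedCategory.braiding_tensor_left_hom]

lemma right_act_comp (M : Mod S H) (s t : H ⟶ H) :
    ((β_ H M.X).inv ≫ s ▷ M.X ≫ act M) ▷ H ≫ (β_ H M.X).inv ≫ t ▷ M.X ≫ act M =
      (α_ M.X H H).hom ≫ M.X ◁ ((β_ H H).inv ≫ (t ⊗ₘ s) ≫ μ[H]) ≫ (β_ H M.X).inv ≫ act M := by
  have hb : M.X ◁ (β_ H H).inv ≫ (β_ (H ⊗ H) M.X).inv =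
      (β_ (H ⊗ H) M.X).inv ≫ (β_ H H).inv ▷ M.X :=
    BraidedCategory.braiding_inv_naturality_right _ _
  have hm : M.X ◁ ((t ⊗ₘ s) ≫ μ[H]) ≫ (β_ H M.X).inv ≫ act M =
      (β_ (H ⊗ H) M.X).inv ≫ (t ⊗ₘ s) ▷ M.X ≫ (α_ H H M.X).hom ≫ H ◁ act M ≫ act M := by
    rw [BraidedCategory.braiding_inv_naturality_right_assoc, comp_whiskerRight_assoc, mul_act]
  rw [whiskerLeft_comp_assoc, hm, reassoc_of% hb, comp_whiskerRight_assoc,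
    BraidedCategory.braiding_inv_naturality_left_assoc]
  simp [MonoidalCategory.tensorHom_def', whisker_exchange_assoc]

lemma toFree_eq [IsIso 𝒮[H]] (a : H ⊗ X ⟶ X) :
    toFree a = coTwist ((β_ H X).inv ≫ inv 𝒮[H] ▷ X ≫ a) ≫ (β_ H X).inv := by
  simp [toFree, coTwist]

lemma coTwist_counit (M : Mod S H) (c : H ⊗ H ⟶ H)
    (hc : Δ[H] ≫ c = ε[H] ≫ η[H]) :
    coTwist (M.X ◁ Δ[H] ≫ (α_ M.X H H).inv ≫ (α_ M.X H H).hom ≫ M.X ◁ c ≫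
      (β_ H M.X).inv ≫ act M) = 𝟙 _ := by
  have h : M.X ◁ Δ[H] ≫ (α_ M.X H H).inv ≫ (α_ M.X H H).hom ≫ M.X ◁ c ≫
      (β_ H M.X).inv ≫ act M = M.X ◁ ε[H] ≫ (ρ_ M.X).hom := by
    rw [Iso.inv_hom_id_assoc, ← whiskerLeft_comp_assoc, hc, whiskerLeft_comp_assoc,
      BraidedCategory.braiding_inv_naturality_right_assoc, one_act]
    simp
  rw [h, coTwist]
  have e : M.X ◁ Δ[H] ≫ M.X ◁ ε[H] ▷ H = M.X ◁ (λ_ H).inv := by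
    rw [← whiskerLeft_comp, ComonObj.counit_comul]
  simp [reassoc_of% e]

lemma toFree_fromFree [IsIso 𝒮[H]] (M : Mod S H) :
    toFree (act M) ≫ fromFree (act M) = 𝟙 _ := by
  have h := right_act_comp M (inv 𝒮[H]) (𝟙 H)
  simp only [id_whiskerRight, Category.id_comp, id_tensorHom] at h
  rw [toFree_eq, Category.assoc, fromFree_eq, coTwist_comp, h]
  exact coTwist_counit M _ (inv_antipode_right H)

lemma fromFree_toFree [IsIso 𝒮[H]] (M : Mod S H) :
    fromFree (act M) ≫ toFree (act M) = 𝟙 _ := by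
  have h := right_act_comp M (𝟙 H) (inv 𝒮[H])
  simp only [id_whiskerRight, Category.id_comp, tensorHom_id] at h
  have e : coTwist ((β_ H M.X).inv ≫ act M) ≫
      coTwist ((β_ H M.X).inv ≫ inv 𝒮[H] ▷ M.X ≫ act M) = 𝟙 _ := by
    rw [coTwist_comp, h]
    exact coTwist_counit M _ (inv_antipode_left H)
  rw [← cancel_epi (β_ H M.X).inv, ← Category.assoc, fromFree_eq, toFree_eq, reassoc_of% e]
  simp

lemma whiskerLeft_unit_diagAct (a : H ⊗ X ⟶ X) (V : S) :
    H ◁ (X ◁ ((λ_ V).inv ≫ η[H] ▷ V)) ≫ diagAct a (freeAct H V) =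
      (α_ H X V).inv ≫ fromFree a ▷ V ≫ (α_ X H V).hom := by
  have h := tensorμ_natural_right H H (𝟙 X) ((λ_ V).inv ≫ η[H] ▷ V)
  simp only [id_tensorHom, MonoidalCategory.whiskerLeft_id] at h
  have k : H ◁ (η[H] ▷ V) ≫ freeAct H V = H ◁ (λ_ V).hom := by
    rw [freeAct, associator_inv_naturality_middle_assoc, ← comp_whiskerRight, MonObj.mul_one]
    simp
  rw [diagAct, whisker_exchange_assoc, pairAct, reassoc_of% h]
  have k' : ((H ⊗ X) ◁ H ◁ ((λ_ V).inv ≫ η[H] ▷ V)) ≫ (a ⊗ₘ freeAct H V) = a ▷ (H ⊗ V) := by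
    rw [← comp_tensorHom_right, MonoidalCategory.whiskerLeft_comp, Category.assoc, k]
    simp
  rw [k']
  simp [tensorμ, fromFree]

lemma whiskerRight_unit_diagAct (b : H ⊗ Y ⟶ Y) (V : S) :
    H ◁ (((λ_ V).inv ≫ η[H] ▷ V) ▷ Y) ≫ diagAct (freeAct H V) b =
      Δ[H] ▷ (V ⊗ Y) ≫ tensorμ H H V Y ≫ (H ⊗ V) ◁ b := by
  have h := tensorμ_natural_right H H ((λ_ V).inv ≫ η[H] ▷ V) (𝟙 Y)
  simp only [tensorHom_id, MonoidalCategory.whiskerLeft_id] at h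
  have k : H ◁ (η[H] ▷ V) ≫ freeAct H V = H ◁ (λ_ V).hom := by
    rw [freeAct, associator_inv_naturality_middle_assoc, ← comp_whiskerRight, MonObj.mul_one]
    simp
  rw [diagAct, whisker_exchange_assoc, pairAct, reassoc_of% h]
  have k' : (H ◁ ((λ_ V).inv ≫ η[H] ▷ V)) ▷ (H ⊗ Y) ≫ (freeAct H V ⊗ₘ b) = (H ⊗ V) ◁ b := by
    rw [← comp_tensorHom_left, MonoidalCategory.whiskerLeft_comp, Category.assoc, k]
    simp
  rw [k']

end Modules

section Extension

variable {S : Type u} [Category.{v} S] [MonoidalCategory S] [BraidedCategory S]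

/-! ### The category `Rep_S(H) ⊔ S` and its tensor product

`Mod S H` is the category of left `H`-modules in `S`. The sum of categories has the objects of both
summands, and no morphisms between an object of the first and an object of the second. -/

/-- The disjoint union of the category of `H`-modules in `S` (degree `0`, `Sum.inl`) and of `S`
(degree `1`, `Sum.inr`). -/
abbrev ExtCat (S : Type u) [Category.{v} S] [MonoidalCategory S] [BraidedCategory S]
    (H : S) [HopfObj H] := Mod S H ⊕ S

variable {H : S} [HopfObj H]

/-- A morphism of modules as a morphism in degree `0`. -/
def degZero {M N : Mod S H} (f : M ⟶ N) : (Sum.inl M : ExtCat S H) ⟶ Sum.inl N :=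
  (Sum.inl_ (Mod S H) S).map f

/-- A morphism of `S` as a morphism in degree `1`. -/
def degOne {X Y : S} (f : X ⟶ Y) : (Sum.inr X : ExtCat S H) ⟶ Sum.inr Y :=
  (Sum.inr_ (Mod S H) S).map f

/-- The tensor product of `H ⊗ -` with two modules, one module, or no module. -/
def extObj : ExtCat S H → ExtCat S H → ExtCat S H
  | .inl M, .inl N => .inl (tensorMod M N)
  | .inl M, .inr Y => .inr (M.X ⊗ Y)
  | .inr X, .inl N => .inr (X ⊗ N.X)
  | .inr X, .inr Y => .inl (freeMod H (X ⊗ Y))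

/-- The tensor product of two module maps. -/
def tensorModMap {M M' N N' : Mod S H} (f : M ⟶ M') (g : N ⟶ N') :
    tensorMod M N ⟶ tensorMod M' N' :=
  mkHom (M := tensorMod M N) (N := tensorMod M' N') (f.hom ⊗ₘ g.hom)
    (diagAct_map (act_hom f) (act_hom g))

/-- The map of free modules `id ⊗ f`. -/
def freeModMap (H : S) [HopfObj H] {X Y : S} (f : X ⟶ Y) : freeMod H X ⟶ freeMod H Y :=
  mkHom (M := freeMod H X) (N := freeMod H Y) (H ◁ f) (freeAct_map f)

/-- The tensor product of morphisms. -/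
def extMap : {A A' B B' : ExtCat S H} → (A ⟶ A') → (B ⟶ B') → (extObj A B ⟶ extObj A' B')
  | .inl _, .inl _, .inl _, .inl _, f, g => degZero (tensorModMap f.down g.down)
  | .inl _, .inl _, .inr _, .inr _, f, g => degOne (f.down.hom ⊗ₘ g.down)
  | .inr _, .inr _, .inl _, .inl _, f, g => degOne (f.down ⊗ₘ g.down.hom)
  | .inr _, .inr _, .inr _, .inr _, f, g => degZero (freeModMap H (f.down ⊗ₘ g.down))

/-! ### The associators, for given `γ₀, δ : 𝟙 ⟶ H ⊗ H` and `φ : H ⟶ H` -/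

/-- Modules `M`, `N`, `P`: the associator of `S`. -/
def assocMMM (M N P : Mod S H) :
    tensorMod M (tensorMod N P) ⟶ tensorMod (tensorMod M N) P :=
  mkHom (M := tensorMod M (tensorMod N P)) (N := tensorMod (tensorMod M N) P)
    (α_ M.X N.X P.X).inv (by
      have h := diagAct_assoc (act M) (act N) (act P)
      change diagAct (act M) (diagAct (act N) (act P)) ≫ (α_ M.X N.X P.X).inv =
        H ◁ (α_ M.X N.X P.X).inv ≫ diagAct (diagAct (act M) (act N)) (act P)
      rw [Iso.comp_inv_eq, Category.assoc, h, whiskerLeft_inv_hom_assoc])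

/-- Modules `M`, `P` and `Y` in `S`: move `P` to the left of `Y` by the inverse braiding, act with
`γ₀` on `M ⊗ P`, and move `P` back. -/
def assocMYP (γ₀ : 𝟙_ S ⟶ H ⊗ H) (M : Mod S H) (Y : S) (P : Mod S H) :
    M.X ⊗ (Y ⊗ P.X) ⟶ (M.X ⊗ Y) ⊗ P.X :=
  M.X ◁ (β_ P.X Y).inv ≫ (α_ M.X P.X Y).inv ≫
    ((λ_ (M.X ⊗ P.X)).inv ≫ γ₀ ▷ (M.X ⊗ P.X) ≫ pairAct (act M) (act P)) ▷ Y ≫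
    (α_ M.X P.X Y).hom ≫ M.X ◁ (β_ P.X Y).hom ≫ (α_ M.X Y P.X).inv

/-- The morphism in `S` underlying the associator of a module `M` and `Y`, `Z` in `S`:
`m ⊗ h ⊗ y ⊗ z ↦ h₂ ⊗ S⁻¹(h₁) m ⊗ y ⊗ z`, where `h₁` and then `h₂` move to the left of `m` by the
inverse braiding. -/
noncomputable def assocMYZHom [IsIso 𝒮[H]] (M : Mod S H) (Y Z : S) :
    M.X ⊗ (H ⊗ (Y ⊗ Z)) ⟶ H ⊗ ((M.X ⊗ Y) ⊗ Z) :=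
  (α_ M.X H (Y ⊗ Z)).inv ≫ toFree (act M) ▷ (Y ⊗ Z) ≫ (α_ H M.X (Y ⊗ Z)).hom ≫
    H ◁ (α_ M.X Y Z).inv

/-- A morphism `f` from `X` to a module `M` extends to a module map `h ⊗ x ↦ h f(x)`. -/
def freeLift {X : S} (M : Mod S H) (f : X ⟶ M.X) : freeMod H X ⟶ M :=
  mkHom (M := freeMod H X) (H ◁ f ≫ act M) (freeAct_lift M f)

lemma assocMYZ_inv [IsIso 𝒮[H]] (M : Mod S H) (Y Z : S) :
    (freeLift (tensorMod M (freeMod H (Y ⊗ Z))) ((α_ M.X Y Z).hom ≫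
      M.X ◁ ((λ_ (Y ⊗ Z)).inv ≫ η[H] ▷ (Y ⊗ Z)))).hom =
    H ◁ (α_ M.X Y Z).hom ≫ (α_ H M.X (Y ⊗ Z)).inv ≫ fromFree (act M) ▷ (Y ⊗ Z) ≫
      (α_ M.X H (Y ⊗ Z)).hom := by
  change H ◁ _ ≫ diagAct (act M) (freeAct H (Y ⊗ Z)) = _
  rw [whiskerLeft_comp_assoc, whiskerLeft_unit_diagAct]

/-- The associator of a module `M` and `Y`, `Z` in `S`, as a module map. -/
noncomputable def assocMYZ [IsIso 𝒮[H]] (M : Mod S H) (Y Z : S) :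
    tensorMod M (freeMod H (Y ⊗ Z)) ⟶ freeMod H ((M.X ⊗ Y) ⊗ Z) :=
  mkHom (M := tensorMod M (freeMod H (Y ⊗ Z))) (N := freeMod H ((M.X ⊗ Y) ⊗ Z))
    (assocMYZHom M Y Z) (by
      set L := freeLift (tensorMod M (freeMod H (Y ⊗ Z))) ((α_ M.X Y Z).hom ≫
        M.X ◁ ((λ_ (Y ⊗ Z)).inv ≫ η[H] ▷ (Y ⊗ Z))) with hL
      have e : L.hom = _ := assocMYZ_inv M Y Z
      have h₁ : L.hom ≫ assocMYZHom M Y Z = 𝟙 _ := by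
        rw [e, assocMYZHom]
        simp only [Category.assoc, Iso.hom_inv_id_assoc]
        rw [← comp_whiskerRight_assoc, fromFree_toFree]
        simp
      have h₂ : assocMYZHom M Y Z ≫ L.hom = 𝟙 _ := by
        rw [e, assocMYZHom]
        simp only [Category.assoc, whiskerLeft_inv_hom_assoc, Iso.hom_inv_id_assoc]
        rw [← comp_whiskerRight_assoc, toFree_fromFree]
        simp
      have k := act_hom L
      have k' := congrArg (fun f => H ◁ assocMYZHom M Y Z ≫ f ≫ assocMYZHom M Y Z) k
      simp only [Category.assoc, h₁] at k'
      rw [← whiskerLeft_comp_assoc, h₂] at k'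
      refine Eq.trans ?_ (k'.symm.trans ?_)
      · simp
      · exact congrArg (fun f => H ◁ assocMYZHom M Y Z ≫ f) (Category.comp_id _))

/-- `X`, `Z` in `S` and a module `N`: `h ⊗ x ⊗ n ⊗ z ↦ h δ₁ ⊗ x ⊗ δ₂ n ⊗ z`, where `δ₂` moves to the
right of `x` by the braiding. -/
def assocXNZ (δ : 𝟙_ S ⟶ H ⊗ H) (X : S) (N : Mod S H) (Z : S) :
    freeMod H (X ⊗ (N.X ⊗ Z)) ⟶ freeMod H ((X ⊗ N.X) ⊗ Z) :=
  freeLift (freeMod H ((X ⊗ N.X) ⊗ Z))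
    ((λ_ (X ⊗ (N.X ⊗ Z))).inv ≫ δ ▷ (X ⊗ (N.X ⊗ Z)) ≫ tensorμ H H X (N.X ⊗ Z) ≫
      (H ⊗ X) ◁ ((α_ H N.X Z).inv ≫ act N ▷ Z) ≫ (α_ H X (N.X ⊗ Z)).hom ≫
      H ◁ (α_ X N.X Z).inv)

/-- `X`, `Y` in `S` and a module `P`: `h ⊗ x ⊗ y ⊗ p ↦ h₁ ⊗ x ⊗ y ⊗ h₂ p`, where `h₂` moves to the
right of `x ⊗ y` by the braiding. -/
def assocXYP (X Y : S) (P : Mod S H) :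
    freeMod H (X ⊗ (Y ⊗ P.X)) ⟶ tensorMod (freeMod H (X ⊗ Y)) P :=
  mkHom (M := freeMod H (X ⊗ (Y ⊗ P.X))) (N := tensorMod (freeMod H (X ⊗ Y)) P)
    (H ◁ (α_ X Y P.X).inv ≫ Δ[H] ▷ ((X ⊗ Y) ⊗ P.X) ≫ tensorμ H H (X ⊗ Y) P.X ≫
      (H ⊗ (X ⊗ Y)) ◁ act P) (by
      have e : H ◁ (α_ X Y P.X).inv ≫ Δ[H] ▷ ((X ⊗ Y) ⊗ P.X) ≫ tensorμ H H (X ⊗ Y) P.X ≫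
          (H ⊗ (X ⊗ Y)) ◁ act P =
          (freeLift (tensorMod (freeMod H (X ⊗ Y)) P) ((α_ X Y P.X).inv ≫
            ((λ_ (X ⊗ Y)).inv ≫ η[H] ▷ (X ⊗ Y)) ▷ P.X)).hom := by
        change _ = H ◁ _ ≫ diagAct (freeAct H (X ⊗ Y)) (act P)
        rw [whiskerLeft_comp_assoc, whiskerRight_unit_diagAct]
      rw [e]
      exact act_hom _)

/-- `X`, `Y`, `Z` in `S`: apply `φ` to `H` and move `H` to the left of `X` by the inverse
braiding. -/
def assocXYZ (φ : H ⟶ H) (X Y Z : S) :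
    X ⊗ (H ⊗ (Y ⊗ Z)) ⟶ (H ⊗ (X ⊗ Y)) ⊗ Z :=
  (α_ X H (Y ⊗ Z)).inv ≫ (X ◁ φ ≫ (β_ H X).inv) ▷ (Y ⊗ Z) ≫ (α_ H X (Y ⊗ Z)).hom ≫
    H ◁ (α_ X Y Z).inv ≫ (α_ H (X ⊗ Y) Z).inv

/-- The associator `A ⊗ (B ⊗ C) ⟶ (A ⊗ B) ⊗ C` given by `γ₀`, `δ`, `φ`. -/
noncomputable def extAssoc [IsIso 𝒮[H]] (γ₀ δ : 𝟙_ S ⟶ H ⊗ H) (φ : H ⟶ H) :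
    (A B C : ExtCat S H) → (extObj A (extObj B C) ⟶ extObj (extObj A B) C)
  | .inl M, .inl N, .inl P => degZero (assocMMM M N P)
  | .inl M, .inl N, .inr Z => degOne (α_ M.X N.X Z).inv
  | .inl M, .inr Y, .inl P => degOne (assocMYP γ₀ M Y P)
  | .inr X, .inl N, .inl P => degOne (α_ X N.X P.X).inv
  | .inl M, .inr Y, .inr Z => degZero (assocMYZ M Y Z)
  | .inr X, .inl N, .inr Z => degZero (assocXNZ δ X N Z)
  | .inr X, .inr Y, .inl P => degZero (assocXYP X Y P)
  | .inr X, .inr Y, .inr Z => degOne (assocXYZ φ X Y Z)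

/-- The pentagon equation for all quadruples of objects. -/
def Pentagon [IsIso 𝒮[H]] (γ₀ δ : 𝟙_ S ⟶ H ⊗ H) (φ : H ⟶ H) : Prop :=
  ∀ A B C D : ExtCat S H,
    extAssoc γ₀ δ φ A B (extObj C D) ≫ extAssoc γ₀ δ φ (extObj A B) C D =
      extMap (𝟙 A) (extAssoc γ₀ δ φ B C D) ≫ extAssoc γ₀ δ φ A (extObj B C) D ≫
        extMap (extAssoc γ₀ δ φ A B C) (𝟙 D)

end Extension

section Elements

variable {S : Type u} [Category.{v} S] [MonoidalCategory S] [BraidedCategory S]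

/-! ### Elements of algebras, and cointegrals -/

/-- `y` is a two-sided multiplicative inverse of the element `x` of the algebra `A`. -/
def IsMulInv {A : S} [MonObj A] (x y : 𝟙_ S ⟶ A) : Prop :=
  (λ_ (𝟙_ S)).inv ≫ (x ⊗ₘ y) ≫ μ[A] = η[A] ∧ (λ_ (𝟙_ S)).inv ≫ (y ⊗ₘ x) ≫ μ[A] = η[A]

/-- `x` has a multiplicative inverse. -/
def HasMulInv {A : S} [MonObj A] (x : 𝟙_ S ⟶ A) : Prop := ∃ y, IsMulInv x y

/-- Left multiplication by an element. -/
def leftMul {A : S} [MonObj A] (x : 𝟙_ S ⟶ A) : A ⟶ A := (λ_ A).inv ≫ x ▷ A ≫ μ[A]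

/-- Right multiplication by an element. -/
def rightMul {A : S} [MonObj A] (x : 𝟙_ S ⟶ A) : A ⟶ A := (ρ_ A).inv ≫ A ◁ x ≫ μ[A]

/-- The conjugation `a ↦ x a y`, for `y` the multiplicative inverse of `x`. -/
def adConj {A : S} [MonObj A] (x y : 𝟙_ S ⟶ A) : A ⟶ A := rightMul y ≫ leftMul x

/-- `g` is group-like: `Δ ∘ g = g ⊗ g` and `ε ∘ g = 1`. -/
def IsGroupLike {A : S} [ComonObj A] (g : 𝟙_ S ⟶ A) : Prop :=
  g ≫ Δ[A] = (λ_ (𝟙_ S)).inv ≫ (g ⊗ₘ g) ∧ g ≫ ε[A] = 𝟙 (𝟙_ S)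

/-- `lam : H ⟶ 𝟙` is a right cointegral: `(lam ⊗ id) ∘ Δ = η ∘ lam`. -/
def IsRightCointegral {H : S} [HopfObj H] (lam : H ⟶ 𝟙_ S) : Prop :=
  Δ[H] ≫ lam ▷ H ≫ (λ_ H).hom = lam ≫ η[H]

/-- `(id ⊗ lam) ∘ Δ = g ∘ lam`. -/
def IsDistinguished {H : S} [HopfObj H] (lam : H ⟶ 𝟙_ S) (g : 𝟙_ S ⟶ H) : Prop :=
  Δ[H] ≫ H ◁ lam ≫ (ρ_ H).hom = lam ≫ g

end Elements

section Dual

variable {S : Type u} [Category.{v} S] [MonoidalCategory S] [BraidedCategory S]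
  [RightRigidCategory S]

/-! ### The dual Hopf algebra

The structure maps of `Hᘁ` are the duals of those of `H`, for the duality between `H ⊗ H` and
`Hᘁ ⊗ Hᘁ` in which the inner factors are paired first (no braiding occurs). -/

/-- `(Hᘁ ⊗ Hᘁ) ⊗ (H ⊗ H) ⟶ 𝟙`, inner factors first. -/
def dualPair (H : S) : (dual H ⊗ dual H) ⊗ (H ⊗ H) ⟶ 𝟙_ S :=
  (α_ (dual H) (dual H) (H ⊗ H)).hom ≫
    dual H ◁ ((α_ (dual H) H H).inv ≫ ε_ H (dual H) ▷ H ≫ (λ_ H).hom) ≫ ε_ H (dual H)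

/-- `𝟙 ⟶ (H ⊗ H) ⊗ (Hᘁ ⊗ Hᘁ)`, inner factors nested in the outer ones. -/
def dualCopair (H : S) : 𝟙_ S ⟶ (H ⊗ H) ⊗ (dual H ⊗ dual H) :=
  η_ H (dual H) ≫
    H ◁ ((λ_ (dual H)).inv ≫ η_ H (dual H) ▷ dual H ≫ (α_ H (dual H) (dual H)).hom) ≫
    (α_ H H (dual H ⊗ dual H)).inv

variable (H : S) [HopfObj H]

/-- The product of the dual Hopf algebra, the dual of `Δ`. -/
def dualMul : dual H ⊗ dual H ⟶ dual H :=
  (ρ_ (dual H ⊗ dual H)).inv ≫ (dual H ⊗ dual H) ◁ (η_ H (dual H) ≫ Δ[H] ▷ dual H) ≫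
    (α_ (dual H ⊗ dual H) (H ⊗ H) (dual H)).inv ≫ dualPair H ▷ dual H ≫ (λ_ (dual H)).hom

/-- The unit of the dual Hopf algebra, the dual of `ε`. -/
def dualOne : 𝟙_ S ⟶ dual H :=
  η_ H (dual H) ≫ ε[H] ▷ dual H ≫ (λ_ (dual H)).hom

/-- The coproduct of the dual Hopf algebra, the dual of `μ`. -/
def dualComul : dual H ⟶ dual H ⊗ dual H :=
  (ρ_ (dual H)).inv ≫ dual H ◁ (dualCopair H ≫ μ[H] ▷ (dual H ⊗ dual H)) ≫
    (α_ (dual H) H (dual H ⊗ dual H)).inv ≫ ε_ H (dual H) ▷ (dual H ⊗ dual H) ≫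
    (λ_ (dual H ⊗ dual H)).hom

/-- The counit of the dual Hopf algebra, the dual of `η`. -/
def dualCounit : dual H ⟶ 𝟙_ S := (ρ_ (dual H)).inv ≫ dual H ◁ η[H] ≫ ε_ H (dual H)

/-- The antipode of the dual Hopf algebra, the dual of the antipode of `H`. -/
noncomputable def dualAntipode : dual H ⟶ dual H := (𝒮[H])ᘁ

/-- `Γ` is an isomorphism of Hopf algebras from the dual Hopf algebra of `H` to `H`. -/
structure IsDualHopfIso {H : S} [HopfObj H] (Γ : dual H ⟶ H) : Prop where
  isIso : IsIso Γ
  map_mul : dualMul H ≫ Γ = (Γ ⊗ₘ Γ) ≫ μ[H]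
  map_one : dualOne H ≫ Γ = η[H]
  map_comul : Γ ≫ Δ[H] = dualComul H ≫ (Γ ⊗ₘ Γ)
  map_counit : Γ ≫ ε[H] = dualCounit H
  map_antipode : dualAntipode H ≫ Γ = Γ ≫ 𝒮[H]

variable {H}

/-- The morphism `Hᘁ ⟶ H` given by `(ev ⊗ id) ∘ (id ⊗ id ⊗ S) ∘ (id ⊗ γ₀)`. -/
def capGamma (γ₀ : 𝟙_ S ⟶ H ⊗ H) : dual H ⟶ H :=
  (ρ_ (dual H)).inv ≫ dual H ◁ (γ₀ ≫ H ◁ 𝒮[H]) ≫ (α_ (dual H) H H).inv ≫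
    ε_ H (dual H) ▷ H ≫ (λ_ H).hom

/-- `(S⁻¹ ⊗ Γ) ∘ coev`. -/
noncomputable def gammaOf [IsIso 𝒮[H]] (Γ : dual H ⟶ H) : 𝟙_ S ⟶ H ⊗ H :=
  η_ H (dual H) ≫ (inv 𝒮[H] ⊗ₘ Γ)

/-- `(S ⊗ (M_g ∘ Γ)) ∘ coev`, where `M_g` is right multiplication by `g`. -/
def deltaOf (Γ : dual H ⟶ H) (g : 𝟙_ S ⟶ H) : 𝟙_ S ⟶ H ⊗ H :=
  η_ H (dual H) ≫ (𝒮[H] ⊗ₘ (Γ ≫ rightMul g))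

/-- `(id ⊗ (lam ∘ μ)) ∘ (id ⊗ Γ ⊗ id) ∘ (coev ⊗ id)`. -/
def phiOf (Γ : dual H ⟶ H) (lam : H ⟶ 𝟙_ S) : H ⟶ H :=
  (λ_ H).inv ≫ (η_ H (dual H) ≫ H ◁ Γ) ▷ H ≫ (α_ H H H).hom ≫ H ◁ (μ[H] ≫ lam) ≫ (ρ_ H).hom

end Dual

end HopfExt

open HopfExt

namespace HopfExt

section Components
variable {S : Type u} [Category.{v} S] [MonoidalCategory S] [BraidedCategory S]

/-- The left regular module. -/
abbrev regMod (H : S) [HopfObj H] : Mod S H := mkMod H μ[H] (MonObj.one_mul H) (MonObj.mul_assoc H)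

variable {H : S} [HopfObj H]

/-- The morphism underlying `assocMYP`, for arbitrary actions. -/
def homMYP {X P : S} (γ₀ : 𝟙_ S ⟶ H ⊗ H) (a : H ⊗ X ⟶ X) (Y : S) (b : H ⊗ P ⟶ P) :
    X ⊗ (Y ⊗ P) ⟶ (X ⊗ Y) ⊗ P :=
  X ◁ (β_ P Y).inv ≫ (α_ X P Y).inv ≫
    ((λ_ (X ⊗ P)).inv ≫ γ₀ ▷ (X ⊗ P) ≫ pairAct a b) ▷ Y ≫
    (α_ X P Y).hom ≫ X ◁ (β_ P Y).hom ≫ (α_ X Y P).inv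

/-- The morphism underlying `assocMYZ`, for an arbitrary action. -/
noncomputable def homMYZ [IsIso 𝒮[H]] {X : S} (a : H ⊗ X ⟶ X) (Y Z : S) :
    X ⊗ (H ⊗ (Y ⊗ Z)) ⟶ H ⊗ ((X ⊗ Y) ⊗ Z) :=
  (α_ X H (Y ⊗ Z)).inv ≫ toFree a ▷ (Y ⊗ Z) ≫ (α_ H X (Y ⊗ Z)).hom ≫
    H ◁ (α_ X Y Z).inv

/-- The morphism underlying `assocXNZ`, for an arbitrary action. -/
def homXNZ {N : S} (δ : 𝟙_ S ⟶ H ⊗ H) (X : S) (b : H ⊗ N ⟶ N) (Z : S) :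
    H ⊗ (X ⊗ (N ⊗ Z)) ⟶ H ⊗ ((X ⊗ N) ⊗ Z) :=
  H ◁ ((λ_ (X ⊗ (N ⊗ Z))).inv ≫ δ ▷ (X ⊗ (N ⊗ Z)) ≫ tensorμ H H X (N ⊗ Z) ≫
      (H ⊗ X) ◁ ((α_ H N Z).inv ≫ b ▷ Z) ≫ (α_ H X (N ⊗ Z)).hom ≫
      H ◁ (α_ X N Z).inv) ≫ freeAct H ((X ⊗ N) ⊗ Z)

/-- The morphism underlying `assocXYP`, for an arbitrary action. -/
def homXYP {P : S} (X Y : S) (c : H ⊗ P ⟶ P) : H ⊗ (X ⊗ (Y ⊗ P)) ⟶ (H ⊗ (X ⊗ Y)) ⊗ P :=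
  H ◁ (α_ X Y P).inv ≫ Δ[H] ▷ ((X ⊗ Y) ⊗ P) ≫ tensorμ H H (X ⊗ Y) P ≫ (H ⊗ (X ⊗ Y)) ◁ c

lemma pairAct_one_left {Y : S} (b : H ⊗ Y ⟶ Y) :
    (H ⊗ H) ◁ (η[H] ▷ Y) ≫ pairAct μ[H] b = (H ⊗ H) ◁ (λ_ Y).hom ≫ (α_ H H Y).hom ≫ H ◁ b := by
  have h := tensorμ_natural_right H H η[H] (𝟙 Y)
  simp only [tensorHom_id, MonoidalCategory.whiskerLeft_id] at h
  rw [pairAct, reassoc_of% h, ← comp_tensorHom_left, MonObj.mul_one]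
  simp [tensorμ, MonoidalCategory.tensorHom_def]
  monoidal

lemma pairAct_one_right {X : S} (a : H ⊗ X ⟶ X) :
    (H ⊗ H) ◁ (X ◁ η[H]) ≫ pairAct a μ[H] = (H ⊗ H) ◁ (ρ_ X).hom ≫ (α_ H H X).hom ≫
      H ◁ (β_ H X).hom ≫ (α_ H X H).inv ≫ a ▷ H := by
  have h := tensorμ_natural_right H H (𝟙 X) η[H]
  simp only [id_tensorHom, MonoidalCategory.whiskerLeft_id] at h
  rw [pairAct, reassoc_of% h, ← comp_tensorHom_right, MonObj.mul_one]
  simp [tensorμ, MonoidalCategory.tensorHom_def']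

lemma pairAct_regular : pairAct μ[H] μ[H] = μ[H ⊗ H] := by
  rw [pairAct, MonObj.tensorObj.mul_def]

lemma one_diagAct_regular :
    H ◁ η[H ⊗ H] ≫ diagAct μ[H] μ[H] = (ρ_ H).hom ≫ Δ[H] := by
  rw [diagAct, whisker_exchange_assoc, pairAct_regular, MonObj.mul_one]
  simp

lemma one_homMYP {P : S} (γ₀ : 𝟙_ S ⟶ H ⊗ H) (Y : S) (b : H ⊗ P ⟶ P) :
    η[H] ▷ (Y ⊗ P) ≫ homMYP γ₀ μ[H] Y b = (λ_ _).hom ≫ (λ_ _).inv ≫ γ₀ ▷ (Y ⊗ P) ≫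
      tensorμ H H Y P ≫ (H ⊗ Y) ◁ b := by
  have h : η[H] ▷ P ≫ (λ_ (H ⊗ P)).inv ≫ γ₀ ▷ (H ⊗ P) ≫ pairAct μ[H] b =
      γ₀ ▷ P ≫ (α_ H H P).hom ≫ H ◁ b := by
    rw [leftUnitor_inv_naturality_assoc, whisker_exchange_assoc, pairAct_one_left]
    simp
  calc
    _ = 𝟙 _ ⊗≫ (η[H] ▷ (Y ⊗ P) ≫ H ◁ (β_ P Y).inv) ⊗≫
          ((λ_ (H ⊗ P)).inv ≫ γ₀ ▷ (H ⊗ P) ≫ pairAct μ[H] b) ▷ Y ⊗≫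
          H ◁ (β_ P Y).hom ⊗≫ 𝟙 _ := by rw [homMYP]; monoidal
    _ = 𝟙 _ ⊗≫ (β_ P Y).inv ⊗≫
          (η[H] ▷ P ≫ (λ_ (H ⊗ P)).inv ≫ γ₀ ▷ (H ⊗ P) ≫ pairAct μ[H] b) ▷ Y ⊗≫
          H ◁ (β_ P Y).hom ⊗≫ 𝟙 _ := by rw [← whisker_exchange]; monoidal
    _ = 𝟙 _ ⊗≫ (𝟙_ S ◁ (β_ P Y).inv ≫ γ₀ ▷ (P ⊗ Y)) ⊗≫ H ◁ (b ▷ Y ≫ (β_ P Y).hom) ⊗≫ 𝟙 _ := by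
      rw [h]; monoidal
    _ = 𝟙 _ ⊗≫ γ₀ ▷ (Y ⊗ P) ⊗≫ H ◁ H ◁ ((β_ P Y).inv ≫ (β_ P Y).hom) ⊗≫
          H ◁ (β_ H Y).hom ▷ P ⊗≫ (H ⊗ Y) ◁ b := by
      rw [whisker_exchange, BraidedCategory.braiding_naturality_left,
        BraidedCategory.braiding_tensor_left_hom]
      monoidal
    _ = _ := by
      rw [Iso.inv_hom_id, tensorμ]
      monoidal

lemma homMYP_one_unit {X : S} (γ₀ : 𝟙_ S ⟶ H ⊗ H) (a : H ⊗ X ⟶ X) :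
    X ◁ (𝟙_ S ◁ η[H]) ≫ homMYP γ₀ a (𝟙_ S) μ[H] = X ◁ (λ_ (𝟙_ S)).hom ≫ (ρ_ X).hom ≫
      (λ_ _).inv ≫ γ₀ ▷ _ ≫ (α_ H H X).hom ≫
      H ◁ (β_ H X).hom ≫ (α_ H X H).inv ≫ (a ≫ (ρ_ X).inv) ▷ H := by
  have h : homMYP γ₀ a (𝟙_ S) μ[H] = X ◁ (λ_ H).hom ≫ (λ_ _).inv ≫ γ₀ ▷ _ ≫ pairAct a μ[H] ≫
      (ρ_ X).inv ▷ H := by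
    rw [homMYP, braiding_inv_tensorUnit_right, braiding_tensorUnit_right]
    simp
  rw [h, ← whiskerLeft_comp_assoc, leftUnitor_naturality, whiskerLeft_comp_assoc,
    leftUnitor_inv_naturality_assoc, whisker_exchange_assoc, reassoc_of% pairAct_one_right a]
  simp
  monoidal

lemma assocXYZ_unit (φ : H ⟶ H) (X : S) :
    assocXYZ φ X (𝟙_ S) (𝟙_ S) = X ◁ (H ◁ (λ_ (𝟙_ S)).hom ≫ (ρ_ H).hom ≫ φ) ≫ (β_ H X).inv ≫
      H ◁ (ρ_ X).inv ≫ (ρ_ _).inv := by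
  simp [assocXYZ]
  monoidal

lemma elem_homMYZ [IsIso 𝒮[H]] {X : S} (f : 𝟙_ S ⟶ X) (a : H ⊗ X ⟶ X) (Y Z : S) :
    f ▷ _ ≫ homMYZ a Y Z = (λ_ _).hom ≫ (Δ[H] ≫ inv 𝒮[H] ▷ H ≫ ((ρ_ H).inv ≫ H ◁ f ≫ a) ▷ H ≫
      (β_ H X).inv) ▷ (Y ⊗ Z) ≫ (α_ _ _ _).hom ≫ H ◁ (α_ _ _ _).inv := by
  have h : f ▷ H ≫ toFree a = (λ_ H).hom ≫ Δ[H] ≫ inv 𝒮[H] ▷ H ≫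
      ((ρ_ H).inv ≫ H ◁ f ≫ a) ▷ H ≫ (β_ H X).inv := by
    rw [toFree, ← whisker_exchange_assoc, associator_inv_naturality_left_assoc,
      ← comp_whiskerRight_assoc, BraidedCategory.braiding_inv_naturality_left_assoc,
      whisker_exchange_assoc]
    simp
  rw [homMYZ, associator_inv_naturality_left_assoc, ← comp_whiskerRight_assoc, h]
  simp

lemma one_homXNZ {N : S} (δ : 𝟙_ S ⟶ H ⊗ H) (X : S) (b : H ⊗ N ⟶ N) (Z : S) :
    η[H] ▷ _ ≫ homXNZ δ X b Z = (λ_ _).hom ≫ (λ_ (X ⊗ (N ⊗ Z))).inv ≫ δ ▷ (X ⊗ (N ⊗ Z)) ≫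
      tensorμ H H X (N ⊗ Z) ≫ (H ⊗ X) ◁ ((α_ H N Z).inv ≫ b ▷ Z) ≫ (α_ H X (N ⊗ Z)).hom ≫
      H ◁ (α_ X N Z).inv := by
  rw [homXNZ, ← whisker_exchange_assoc, one_freeAct, leftUnitor_naturality]

lemma braiding_elem {X : S} (d : 𝟙_ S ⟶ H) :
    d ▷ X ≫ (β_ H X).hom = (λ_ X).hom ≫ (ρ_ X).inv ≫ X ◁ d := by
  rw [BraidedCategory.braiding_naturality_left, braiding_tensorUnit_left, Category.assoc]

lemma mul_counit_eq : μ[H] ≫ ε[H] = ε[H] ▷ H ≫ (λ_ H).hom ≫ ε[H] := by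
  simp [MonoidalCategory.tensorHom_def]

lemma homXNZ_counit {N : S} (δ : 𝟙_ S ⟶ H ⊗ H) (X : S) (b : H ⊗ N ⟶ N) (Z : S) :
    homXNZ δ X b Z ≫ ε[H] ▷ _ = ε[H] ▷ _ ≫ 𝟙_ S ◁ (X ◁ ((λ_ N).inv ≫
      (δ ≫ ε[H] ▷ H ≫ (λ_ H).hom) ▷ N ≫ b) ▷ Z ≫ (α_ X N Z).inv) := by
  calc
    _ = 𝟙 _ ⊗≫ H ◁ δ ▷ (X ⊗ (N ⊗ Z)) ⊗≫ H ◁ H ◁ ((β_ H X).hom ▷ N ⊗≫ X ◁ b) ▷ Z ⊗≫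
          (μ[H] ≫ ε[H]) ▷ ((X ⊗ N) ⊗ Z) := by
      rw [homXNZ, freeAct, tensorμ]
      monoidal
    _ = 𝟙 _ ⊗≫ H ◁ δ ▷ (X ⊗ (N ⊗ Z)) ⊗≫ ((H ⊗ H) ◁ ((β_ H X).hom ▷ N ⊗≫ X ◁ b) ▷ Z ≫
          ((ε[H] ▷ H ≫ (λ_ H).hom ≫ ε[H]) ▷ ((X ⊗ N) ⊗ Z))) := by
      rw [mul_counit_eq]
      monoidal
    _ = 𝟙 _ ⊗≫ (H ◁ δ ▷ (X ⊗ (N ⊗ Z)) ≫ ε[H] ▷ ((H ⊗ H) ⊗ (X ⊗ (N ⊗ Z)))) ⊗≫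
         ε[H] ▷ (H ⊗ (X ⊗ (N ⊗ Z))) ⊗≫ ((β_ H X).hom ▷ N ⊗≫ X ◁ b) ▷ Z ⊗≫ 𝟙 _ := by
      rw [whisker_exchange]
      monoidal
    _ = 𝟙 _ ⊗≫ ε[H] ▷ (X ⊗ (N ⊗ Z)) ⊗≫
         ((δ ≫ ε[H] ▷ H ≫ (λ_ H).hom) ▷ X ≫ (β_ H X).hom) ▷ (N ⊗ Z) ⊗≫ X ◁ b ▷ Z ⊗≫ 𝟙 _ := by
      rw [whisker_exchange]
      monoidal
    _ = _ := by
      rw [braiding_elem]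
      monoidal

lemma one_homXYP {P : S} (X Y : S) (c : H ⊗ P ⟶ P) (hc : η[H] ▷ P ≫ c = (λ_ P).hom) :
    η[H] ▷ _ ≫ homXYP X Y c = (λ_ _).hom ≫ (α_ X Y P).inv ≫ ((λ_ _).inv ≫ η[H] ▷ _) ▷ P := by
  calc
    _ = 𝟙 _ ⊗≫ (η[H] ≫ Δ[H]) ▷ ((X ⊗ Y) ⊗ P) ⊗≫ (H ◁ (β_ H (X ⊗ Y)).hom) ▷ P ⊗≫
         (H ⊗ (X ⊗ Y)) ◁ c := by
      rw [homXYP, tensorμ, ← whisker_exchange_assoc]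
      monoidal
    _ = 𝟙 _ ⊗≫ η[H] ▷ ((X ⊗ Y) ⊗ P) ⊗≫ H ◁ (η[H] ▷ (X ⊗ Y) ≫ (β_ H (X ⊗ Y)).hom) ▷ P ⊗≫
         (H ⊗ (X ⊗ Y)) ◁ c := by
      rw [BimonObj.one_comul, MonObj.tensorObj.one_def, MonoidalCategory.tensorHom_def]
      monoidal
    _ = 𝟙 _ ⊗≫ η[H] ▷ ((X ⊗ Y) ⊗ P) ⊗≫ (H ⊗ (X ⊗ Y)) ◁ (η[H] ▷ P ≫ c) := by
      rw [braiding_elem]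
      monoidal
    _ = _ := by
      rw [hc]
      monoidal

lemma homXYP_counit {P : S} (X Y : S) (c : H ⊗ P ⟶ P) :
    homXYP X Y c ≫ ε[H] ▷ (X ⊗ Y) ▷ P = H ◁ (α_ X Y P).inv ≫ (α_ _ _ _).inv ≫
      ((β_ H (X ⊗ Y)).hom ≫ (λ_ _).inv ▷ H) ▷ P ≫ (α_ _ _ _).hom ≫ _ ◁ c := by
  calc
    _ = 𝟙 _ ⊗≫ Δ[H] ▷ ((X ⊗ Y) ⊗ P) ⊗≫ (H ◁ ((β_ H (X ⊗ Y)).hom ▷ P ⊗≫ (X ⊗ Y) ◁ c) ≫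
         ε[H] ▷ ((X ⊗ Y) ⊗ P)) ⊗≫ 𝟙 _ := by
      rw [homXYP, tensorμ]
      monoidal
    _ = 𝟙 _ ⊗≫ (Δ[H] ≫ ε[H] ▷ H) ▷ ((X ⊗ Y) ⊗ P) ⊗≫ (β_ H (X ⊗ Y)).hom ▷ P ⊗≫ (X ⊗ Y) ◁ c ⊗≫
          𝟙 _ := by
      rw [whisker_exchange]
      monoidal
    _ = _ := by
      rw [ComonObj.counit_comul]
      monoidal

lemma homMYP_regular (γ₀ : 𝟙_ S ⟶ H ⊗ H) : homMYP γ₀ μ[H] (𝟙_ S) μ[H] =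
    H ◁ (λ_ H).hom ≫ (λ_ _).inv ≫ γ₀ ▷ _ ≫ μ[H ⊗ H] ≫ (ρ_ H).inv ▷ H := by
  rw [homMYP, braiding_inv_tensorUnit_right, braiding_tensorUnit_right, pairAct_regular]
  simp

lemma one_homMYP_regular (γ₀ : 𝟙_ S ⟶ H ⊗ H) :
    η[H ⊗ H] ≫ H ◁ (λ_ H).inv ≫ homMYP γ₀ μ[H] (𝟙_ S) μ[H] = γ₀ ≫ (ρ_ H).inv ▷ H := by
  rw [homMYP_regular, whiskerLeft_inv_hom_assoc, leftUnitor_inv_naturality_assoc,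
    whisker_exchange_assoc, MonObj.mul_one_assoc]
  monoidal

lemma one_leftMul (d : 𝟙_ S ⟶ H) : η[H] ≫ leftMul d = d := by
  rw [leftMul, leftUnitor_inv_naturality_assoc, whisker_exchange_assoc, MonObj.mul_one]
  monoidal

lemma one_homXNZ_regular (δ : 𝟙_ S ⟶ H ⊗ H) :
    η[H] ≫ (λ_ H).inv ≫ η[H] ▷ H ≫ H ◁ ((ρ_ H).inv ≫ (λ_ _).inv) ≫ homXNZ δ (𝟙_ S) μ[H] (𝟙_ S) =
      δ ≫ H ◁ ((λ_ H).inv ≫ (ρ_ _).inv) := by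
  calc
    _ = 𝟙 _ ⊗≫ η[H] ⊗≫ (η[H] ▷ (𝟙_ S ⊗ H ⊗ 𝟙_ S) ≫ homXNZ δ (𝟙_ S) μ[H] (𝟙_ S)) := by monoidal
    _ = 𝟙 _ ⊗≫ (𝟙_ S ◁ η[H] ≫ δ ▷ H) ⊗≫ H ◁ μ[H] ⊗≫ 𝟙 _ := by
      rw [one_homXNZ, tensorμ, braiding_tensorUnit_right]
      monoidal
    _ = 𝟙 _ ⊗≫ δ ⊗≫ H ◁ (H ◁ η[H] ≫ μ[H]) ⊗≫ 𝟙 _ := by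
      rw [whisker_exchange]
      monoidal
    _ = _ := by
      rw [MonObj.mul_one]
      monoidal

end Components

/-! ### Components of the pentagon

In the names `M`, `N`, `P` stand for the regular module and `X`, `Y`, `Z`, `W` for the unit object.
The components of the pentagon are evaluated at the units of the regular modules, and `counit` refers
to a further application of the counit. -/

section PentagonComponents
variable {S : Type u} [Category.{v} S] [MonoidalCategory S] [BraidedCategory S]
variable {H : S} [HopfObj H] [IsIso 𝒮[H]] {γ₀ δ : 𝟙_ S ⟶ H ⊗ H} {φ : H ⟶ H}

lemma pentagon_MYYY (h : Pentagon γ₀ δ φ) :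
    (λ_ H).inv ≫ γ₀ ▷ H ≫ (α_ H H H).hom ≫ H ◁ (μ[H] ≫ φ) = φ ≫ Δ[H] ≫ inv 𝒮[H] ▷ H := by
  have e := congrArg ULift.down
    (h (.inl (regMod H)) (.inr (𝟙_ S)) (.inr (𝟙_ S)) (.inr (𝟙_ S)))
  replace e : homMYP γ₀ μ[H] (𝟙_ S) (freeAct H (𝟙_ S ⊗ 𝟙_ S)) ≫
      assocXYZ φ (H ⊗ 𝟙_ S) (𝟙_ S) (𝟙_ S) =
    (𝟙 H ⊗ₘ assocXYZ φ (𝟙_ S) (𝟙_ S) (𝟙_ S)) ≫ (α_ H (H ⊗ 𝟙_ S ⊗ 𝟙_ S) (𝟙_ S)).inv ≫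
     (homMYZ μ[H] (𝟙_ S) (𝟙_ S) ⊗ₘ 𝟙 (𝟙_ S)) := e
  simp only [id_tensorHom, tensorHom_id] at e
  rw [← cancel_mono (β_ H H).inv]
  calc
    _ = 𝟙 _ ⊗≫ (η[H] ▷ (𝟙_ S ⊗ H ⊗ 𝟙_ S ⊗ 𝟙_ S) ≫
          homMYP γ₀ μ[H] (𝟙_ S) (freeAct H (𝟙_ S ⊗ 𝟙_ S))) ⊗≫
          assocXYZ φ (H ⊗ 𝟙_ S) (𝟙_ S) (𝟙_ S) ⊗≫ 𝟙 _ := by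
      rw [one_homMYP, assocXYZ_unit, freeAct, BraidedCategory.braiding_tensor_right_inv, tensorμ,
        braiding_tensorUnit_right, braiding_inv_tensorUnit_right]
      monoidal
    _ = 𝟙 _ ⊗≫ η[H] ▷ (𝟙_ S ⊗ H ⊗ 𝟙_ S ⊗ 𝟙_ S) ⊗≫
          (homMYP γ₀ μ[H] (𝟙_ S) (freeAct H (𝟙_ S ⊗ 𝟙_ S)) ≫
          assocXYZ φ (H ⊗ 𝟙_ S) (𝟙_ S) (𝟙_ S)) ⊗≫ 𝟙 _ := by monoidal
    _ = 𝟙 _ ⊗≫ (η[H] ▷ (𝟙_ S ⊗ H ⊗ 𝟙_ S ⊗ 𝟙_ S) ≫ H ◁ assocXYZ φ (𝟙_ S) (𝟙_ S) (𝟙_ S)) ⊗≫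
     (homMYZ μ[H] (𝟙_ S) (𝟙_ S)) ▷ (𝟙_ S) ⊗≫ 𝟙 _ := by
      rw [e]
      monoidal
    _ = 𝟙 _ ⊗≫ assocXYZ φ (𝟙_ S) (𝟙_ S) (𝟙_ S) ⊗≫
          (η[H] ▷ (H ⊗ 𝟙_ S ⊗ 𝟙_ S) ≫ homMYZ μ[H] (𝟙_ S) (𝟙_ S)) ⊗≫ 𝟙 _ := by
      rw [← whisker_exchange]
      monoidal
    _ = _ := by
      rw [elem_homMYZ, assocXYZ_unit, MonObj.mul_one, braiding_inv_tensorUnit_right]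
      monoidal

lemma pentagon_MYNP (h : Pentagon γ₀ δ φ) :
    γ₀ ≫ H ◁ Δ[H] = (λ_ (𝟙_ S)).inv ≫ (γ₀ ⊗ₘ γ₀) ≫ tensorμ H H H H ≫ μ[H] ▷ (H ⊗ H) := by
  have e := congrArg ULift.down
    (h (.inl (regMod H)) (.inr (𝟙_ S)) (.inl (regMod H)) (.inl (regMod H)))
  replace e : homMYP γ₀ μ[H] (𝟙_ S) (diagAct μ[H] μ[H]) ≫ (α_ (H ⊗ 𝟙_ S) H H).inv =
      (𝟙 H ⊗ₘ (α_ (𝟙_ S) H H).inv) ≫ homMYP γ₀ μ[H] (𝟙_ S ⊗ H) μ[H] ≫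
        (homMYP γ₀ μ[H] (𝟙_ S) μ[H] ⊗ₘ 𝟙 H) := e
  simp only [id_tensorHom, tensorHom_id] at e
  calc
    _ = 𝟙 _ ⊗≫ γ₀ ⊗≫ H ◁ (H ◁ η[H ⊗ H] ≫ diagAct μ[H] μ[H]) := by
      rw [one_diagAct_regular]
      monoidal
    _ = 𝟙 _ ⊗≫ (𝟙_ S ◁ η[H ⊗ H] ≫ γ₀ ▷ (H ⊗ H)) ⊗≫ H ◁ diagAct μ[H] μ[H] := by
      rw [whisker_exchange]
      monoidal
    _ = 𝟙 _ ⊗≫ η[H ⊗ H] ⊗≫ (η[H] ▷ (𝟙_ S ⊗ H ⊗ H) ≫ homMYP γ₀ μ[H] (𝟙_ S) (diagAct μ[H] μ[H])) ⊗≫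
         𝟙 _ := by
      rw [one_homMYP, tensorμ, braiding_tensorUnit_right]
      monoidal
    _ = 𝟙 _ ⊗≫ η[H ⊗ H] ⊗≫ η[H] ▷ (𝟙_ S ⊗ H ⊗ H) ⊗≫ (homMYP γ₀ μ[H] (𝟙_ S) (diagAct μ[H] μ[H])
         ≫ (α_ (H ⊗ 𝟙_ S) H H).inv) ⊗≫ 𝟙 _ := by
      monoidal
    _ = 𝟙 _ ⊗≫ η[H ⊗ H] ⊗≫ (η[H] ▷ ((𝟙_ S ⊗ H) ⊗ H) ≫ homMYP γ₀ μ[H] (𝟙_ S ⊗ H) μ[H]) ⊗≫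
        homMYP γ₀ μ[H] (𝟙_ S) μ[H] ▷ H ⊗≫ 𝟙 _ := by
      rw [e]
      monoidal
    _ = 𝟙 _ ⊗≫ η[H] ⊗≫ H ◁ η[H] ⊗≫ γ₀ ▷ (H ⊗ H) ⊗≫ H ◁ (β_ H H).hom ▷ H ⊗≫
       (H ⊗ H) ◁ μ[H] ⊗≫ homMYP γ₀ μ[H] (𝟙_ S) μ[H] ▷ H ⊗≫ 𝟙 _ := by
      rw [one_homMYP, MonObj.tensorObj.one_def, MonoidalCategory.tensorHom_def, tensorμ,
        BraidedCategory.braiding_tensor_right_hom, braiding_tensorUnit_right]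
      monoidal
    _ = 𝟙 _ ⊗≫ η[H] ⊗≫ (𝟙_ S ◁ (H ◁ η[H]) ≫ γ₀ ▷ (H ⊗ H)) ⊗≫ H ◁ (β_ H H).hom ▷ H ⊗≫
       (H ⊗ H) ◁ μ[H] ⊗≫ homMYP γ₀ μ[H] (𝟙_ S) μ[H] ▷ H ⊗≫ 𝟙 _ := by
      monoidal
    _ = 𝟙 _ ⊗≫ (𝟙_ S ◁ η[H] ≫ γ₀ ▷ H) ⊗≫ H ◁ ((H ⊗ H) ◁ η[H] ≫ (β_ H H).hom ▷ H) ⊗≫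
       (H ⊗ H) ◁ μ[H] ⊗≫ homMYP γ₀ μ[H] (𝟙_ S) μ[H] ▷ H ⊗≫ 𝟙 _ := by
      rw [whisker_exchange]
      monoidal
    _ = 𝟙 _ ⊗≫ γ₀ ⊗≫ H ◁ (H ◁ η[H] ≫ (β_ H H).hom) ⊗≫
       (H ⊗ H) ◁ (H ◁ η[H] ≫ μ[H]) ⊗≫ homMYP γ₀ μ[H] (𝟙_ S) μ[H] ▷ H ⊗≫ 𝟙 _ := by
      rw [whisker_exchange, whisker_exchange]
      monoidal
    _ = 𝟙 _ ⊗≫ γ₀ ⊗≫ (H ◁ (𝟙_ S ◁ η[H]) ≫ homMYP γ₀ μ[H] (𝟙_ S) μ[H]) ▷ H ⊗≫ 𝟙 _ := by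
      rw [BraidedCategory.braiding_naturality_right, MonObj.mul_one, braiding_tensorUnit_right]
      monoidal
    _ = _ := by
      rw [homMYP_one_unit, MonoidalCategory.tensorHom_def', tensorμ]
      monoidal

lemma pentagon_MNYP (h : Pentagon γ₀ δ φ) :
    γ₀ ≫ Δ[H] ▷ H = (λ_ (𝟙_ S)).inv ≫ (γ₀ ⊗ₘ γ₀) ≫ tensorμ H H H H ≫ (H ⊗ H) ◁ μ[H] := by
  have e := congrArg ULift.down
    (h (.inl (regMod H)) (.inl (regMod H)) (.inr (𝟙_ S)) (.inl (regMod H)))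
  replace e : (α_ H H (𝟙_ S ⊗ H)).inv ≫ homMYP γ₀ (diagAct μ[H] μ[H]) (𝟙_ S) μ[H] =
      (𝟙 H ⊗ₘ homMYP γ₀ μ[H] (𝟙_ S) μ[H]) ≫ homMYP γ₀ μ[H] (H ⊗ 𝟙_ S) μ[H] ≫
        ((α_ H H (𝟙_ S)).inv ⊗ₘ 𝟙 H) := e
  simp only [id_tensorHom, tensorHom_id] at e
  calc
    _ = 𝟙 _ ⊗≫ γ₀ ⊗≫ (H ◁ η[H ⊗ H] ≫ diagAct μ[H] μ[H]) ▷ H ⊗≫ 𝟙 _ := by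
      rw [one_diagAct_regular]
      monoidal
    _ = 𝟙 _ ⊗≫ γ₀ ⊗≫ H ◁ (H ◁ η[H ⊗ H] ≫ (β_ H (H ⊗ H)).hom) ⊗≫ diagAct μ[H] μ[H] ▷ H ⊗≫ 𝟙 _ := by
      rw [BraidedCategory.braiding_naturality_right, braiding_tensorUnit_right]
      monoidal
    _ = 𝟙 _ ⊗≫ (𝟙_ S ◁ η[H ⊗ H] ≫ γ₀ ▷ (H ⊗ H)) ⊗≫ H ◁ (β_ H (H ⊗ H)).hom ⊗≫
          diagAct μ[H] μ[H] ▷ H ⊗≫ 𝟙 _ := by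
      rw [whisker_exchange]
      monoidal
    _ = 𝟙 _ ⊗≫ η[H ⊗ H] ⊗≫ ((H ⊗ H) ◁ 𝟙_ S ◁ η[H] ≫
          homMYP γ₀ (diagAct μ[H] μ[H]) (𝟙_ S) μ[H]) ⊗≫ 𝟙 _ := by
      rw [homMYP_one_unit]
      monoidal
    _ = 𝟙 _ ⊗≫ η[H ⊗ H] ⊗≫ (H ⊗ H) ◁ 𝟙_ S ◁ η[H] ⊗≫ ((α_ H H (𝟙_ S ⊗ H)).inv ≫
          homMYP γ₀ (diagAct μ[H] μ[H]) (𝟙_ S) μ[H]) ⊗≫ 𝟙 _ := by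
      monoidal
    _ = 𝟙 _ ⊗≫ η[H] ⊗≫ H ◁ (η[H] ▷ 𝟙_ S) ⊗≫ H ◁ (H ◁ 𝟙_ S ◁ η[H] ≫
          homMYP γ₀ μ[H] (𝟙_ S) μ[H]) ⊗≫ homMYP γ₀ μ[H] (H ⊗ 𝟙_ S) μ[H] ⊗≫ 𝟙 _ := by
      rw [e, MonObj.tensorObj.one_def, MonoidalCategory.tensorHom_def]
      monoidal
    _ = 𝟙 _ ⊗≫ η[H] ⊗≫ H ◁ (η[H] ▷ 𝟙_ S ≫ H ◁ η[H]) ⊗≫ H ◁ (H ◁ (λ_ H).inv ≫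
          homMYP γ₀ μ[H] (𝟙_ S) μ[H]) ⊗≫ homMYP γ₀ μ[H] (H ⊗ 𝟙_ S) μ[H] ⊗≫ 𝟙 _ := by
      monoidal
    _ = 𝟙 _ ⊗≫ η[H] ⊗≫ H ◁ η[H] ⊗≫ H ◁ (η[H] ▷ (𝟙_ S ⊗ H) ≫
          homMYP γ₀ μ[H] (𝟙_ S) μ[H]) ⊗≫ homMYP γ₀ μ[H] (H ⊗ 𝟙_ S) μ[H] ⊗≫ 𝟙 _ := by
      rw [← whisker_exchange]
      monoidal
    _ = 𝟙 _ ⊗≫ η[H] ⊗≫ H ◁ (𝟙_ S ◁ η[H] ≫ γ₀ ▷ H) ⊗≫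
          H ◁ H ◁ μ[H] ⊗≫ homMYP γ₀ μ[H] (H ⊗ 𝟙_ S) μ[H] ⊗≫ 𝟙 _ := by
      rw [one_homMYP, tensorμ, braiding_tensorUnit_right]
      monoidal
    _ = 𝟙 _ ⊗≫ (η[H] ▷ 𝟙_ S ≫ H ◁ γ₀) ⊗≫
          H ◁ H ◁ (H ◁ η[H] ≫ μ[H]) ⊗≫ homMYP γ₀ μ[H] (H ⊗ 𝟙_ S) μ[H] ⊗≫ 𝟙 _ := by
      rw [whisker_exchange]
      monoidal
    _ = 𝟙 _ ⊗≫ γ₀ ⊗≫ (η[H] ▷ ((H ⊗ 𝟙_ S) ⊗ H) ≫ homMYP γ₀ μ[H] (H ⊗ 𝟙_ S) μ[H]) ⊗≫ 𝟙 _ := by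
      rw [MonObj.mul_one, ← whisker_exchange]
      monoidal
    _ = _ := by
      rw [one_homMYP, MonoidalCategory.tensorHom_def', tensorμ, tensorμ,
        BraidedCategory.braiding_tensor_right_hom, braiding_tensorUnit_right]
      monoidal

lemma pentagon_XYZP (h : Pentagon γ₀ δ φ) :
    φ ≫ (λ_ H).inv ≫ γ₀ ▷ H ≫ (α_ H H H).hom ≫ H ◁ (β_ H H).hom ≫ (α_ H H H).inv ≫ μ[H] ▷ H =
      Δ[H] ≫ φ ▷ H := by
  have e := congrArg ULift.down
    (h (.inr (𝟙_ S)) (.inr (𝟙_ S)) (.inr (𝟙_ S)) (.inl (regMod H)))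
  replace e : assocXYZ φ (𝟙_ S) (𝟙_ S) (𝟙_ S ⊗ H) ≫
      homMYP γ₀ (freeAct H (𝟙_ S ⊗ 𝟙_ S)) (𝟙_ S) μ[H] =
      (𝟙 (𝟙_ S) ⊗ₘ homXYP (𝟙_ S) (𝟙_ S) μ[H]) ≫ (α_ (𝟙_ S) (H ⊗ 𝟙_ S ⊗ 𝟙_ S) H).inv ≫
      (assocXYZ φ (𝟙_ S) (𝟙_ S) (𝟙_ S) ⊗ₘ 𝟙 H) := e
  simp only [id_tensorHom, tensorHom_id] at e
  calc
    _ = 𝟙 _ ⊗≫ φ ⊗≫ ((H ⊗ 𝟙_ S ⊗ 𝟙_ S) ◁ 𝟙_ S ◁ η[H] ≫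
          homMYP γ₀ (freeAct H (𝟙_ S ⊗ 𝟙_ S)) (𝟙_ S) μ[H]) ⊗≫ 𝟙 _ := by
      rw [homMYP_one_unit, freeAct, BraidedCategory.braiding_tensor_right_hom,
        BraidedCategory.braiding_tensor_right_hom, braiding_tensorUnit_right]
      monoidal
    _ = 𝟙 _ ⊗≫ (φ ▷ 𝟙_ S ≫ H ◁ η[H]) ⊗≫
          homMYP γ₀ (freeAct H (𝟙_ S ⊗ 𝟙_ S)) (𝟙_ S) μ[H] ⊗≫ 𝟙 _ := by
      monoidal
    _ = 𝟙 _ ⊗≫ H ◁ η[H] ⊗≫ (assocXYZ φ (𝟙_ S) (𝟙_ S) (𝟙_ S ⊗ H) ≫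
          homMYP γ₀ (freeAct H (𝟙_ S ⊗ 𝟙_ S)) (𝟙_ S) μ[H]) ⊗≫ 𝟙 _ := by
      rw [← whisker_exchange, assocXYZ, braiding_inv_tensorUnit_right]
      monoidal
    _ = 𝟙 _ ⊗≫ (H ◁ η[H] ≫ Δ[H] ▷ H) ⊗≫ H ◁ μ[H] ⊗≫ φ ▷ H := by
      rw [e, homXYP, tensorμ, assocXYZ_unit, BraidedCategory.braiding_tensor_right_hom,
        braiding_tensorUnit_right, braiding_inv_tensorUnit_right]
      monoidal
    _ = 𝟙 _ ⊗≫ Δ[H] ⊗≫ H ◁ (H ◁ η[H] ≫ μ[H]) ⊗≫ φ ▷ H := by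
      rw [whisker_exchange]
      monoidal
    _ = _ := by
      rw [MonObj.mul_one]
      monoidal

lemma pentagon_XYZW (h : Pentagon γ₀ δ φ) :
    φ ≫ (λ_ H).inv ≫ δ ▷ H ≫ (α_ H H H).hom ≫ H ◁ (μ[H] ≫ φ) =
      Δ[H] ≫ inv 𝒮[H] ▷ H ≫ (β_ H H).inv := by
  have e := congrArg (fun f => f.down.hom)
    (h (.inr (𝟙_ S)) (.inr (𝟙_ S)) (.inr (𝟙_ S)) (.inr (𝟙_ S)))
  replace e : homXYP (𝟙_ S) (𝟙_ S) (freeAct H (𝟙_ S ⊗ 𝟙_ S)) ≫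
      homMYZ (freeAct H (𝟙_ S ⊗ 𝟙_ S)) (𝟙_ S) (𝟙_ S) =
      H ◁ (𝟙 (𝟙_ S) ⊗ₘ assocXYZ φ (𝟙_ S) (𝟙_ S) (𝟙_ S)) ≫
      homXNZ δ (𝟙_ S) (freeAct H (𝟙_ S ⊗ 𝟙_ S)) (𝟙_ S) ≫
      H ◁ (assocXYZ φ (𝟙_ S) (𝟙_ S) (𝟙_ S) ⊗ₘ 𝟙 (𝟙_ S)) := e
  simp only [id_tensorHom, tensorHom_id] at e
  calc
    _ = 𝟙 _ ⊗≫ φ ⊗≫ (η[H] ▷ (𝟙_ S ⊗ ((H ⊗ 𝟙_ S ⊗ 𝟙_ S) ⊗ 𝟙_ S)) ≫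
      homXNZ δ (𝟙_ S) (freeAct H (𝟙_ S ⊗ 𝟙_ S)) (𝟙_ S)) ⊗≫ H ◁ φ ⊗≫ 𝟙 _ := by
      rw [one_homXNZ, freeAct, tensorμ, braiding_tensorUnit_right]
      monoidal
    _ = 𝟙 _ ⊗≫ (𝟙_ S ◁ φ ≫ η[H] ▷ H) ⊗≫
      homXNZ δ (𝟙_ S) (freeAct H (𝟙_ S ⊗ 𝟙_ S)) (𝟙_ S) ⊗≫ H ◁ φ ⊗≫ 𝟙 _ := by
      monoidal
    _ = 𝟙 _ ⊗≫ η[H] ▷ H ⊗≫ (H ◁ 𝟙_ S ◁ assocXYZ φ (𝟙_ S) (𝟙_ S) (𝟙_ S) ≫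
      homXNZ δ (𝟙_ S) (freeAct H (𝟙_ S ⊗ 𝟙_ S)) (𝟙_ S) ≫
      H ◁ assocXYZ φ (𝟙_ S) (𝟙_ S) (𝟙_ S) ▷ 𝟙_ S) ⊗≫ 𝟙 _ := by
      rw [whisker_exchange, assocXYZ_unit, braiding_inv_tensorUnit_right]
      monoidal
    _ = 𝟙 _ ⊗≫ (η[H] ▷ (𝟙_ S ⊗ 𝟙_ S ⊗ (H ⊗ 𝟙_ S ⊗ 𝟙_ S)) ≫
          homXYP (𝟙_ S) (𝟙_ S) (freeAct H (𝟙_ S ⊗ 𝟙_ S))) ⊗≫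
          homMYZ (freeAct H (𝟙_ S ⊗ 𝟙_ S)) (𝟙_ S) (𝟙_ S) ⊗≫ 𝟙 _ := by
      rw [← e]
      monoidal
    _ = 𝟙 _ ⊗≫ ((η[H] ≫ (ρ_ H).inv ≫ H ◁ (λ_ (𝟙_ S)).inv) ▷ (H ⊗ 𝟙_ S ⊗ 𝟙_ S) ≫
          homMYZ (freeAct H (𝟙_ S ⊗ 𝟙_ S)) (𝟙_ S) (𝟙_ S)) ⊗≫ 𝟙 _ := by
      rw [one_homXYP _ _ _ (one_freeAct _)]
      monoidal
    _ = 𝟙 _ ⊗≫ (Δ[H] ≫ inv 𝒮[H] ▷ H) ⊗≫ (H ◁ η[H] ≫ μ[H]) ▷ H ⊗≫ (β_ H H).inv ⊗≫ 𝟙 _ := by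
      rw [elem_homMYZ, freeAct, BraidedCategory.braiding_tensor_right_inv,
        BraidedCategory.braiding_tensor_right_inv, braiding_inv_tensorUnit_right]
      monoidal
    _ = _ := by
      rw [MonObj.mul_one]
      monoidal

lemma pentagon_XNYZ_counit (h : Pentagon γ₀ δ φ) :
    Δ[H] ≫ (inv 𝒮[H] ≫ leftMul (δ ≫ ε[H] ▷ H ≫ (λ_ H).hom)) ▷ H ≫ H ◁ (φ ≫ ε[H]) ≫
      (ρ_ H).hom = φ ≫ ε[H] ≫ η[H] := by
  have e := congrArg ULift.down
    (h (.inr (𝟙_ S)) (.inl (regMod H)) (.inr (𝟙_ S)) (.inr (𝟙_ S)))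
  replace e : (α_ (𝟙_ S) H (H ⊗ 𝟙_ S ⊗ 𝟙_ S)).inv ≫ assocXYZ φ (𝟙_ S ⊗ H) (𝟙_ S) (𝟙_ S) =
      (𝟙 (𝟙_ S) ⊗ₘ homMYZ μ[H] (𝟙_ S) (𝟙_ S)) ≫ assocXYZ φ (𝟙_ S) (H ⊗ 𝟙_ S) (𝟙_ S) ≫
      (homXNZ δ (𝟙_ S) μ[H] (𝟙_ S) ⊗ₘ 𝟙 (𝟙_ S)) := e
  simp only [id_tensorHom, tensorHom_id] at e
  set d := δ ≫ ε[H] ▷ H ≫ (λ_ H).hom with hd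
  symm
  calc
    _ = 𝟙 _ ⊗≫ (𝟙_ S ◁ (φ ≫ ε[H]) ≫ η[H] ▷ 𝟙_ S) ⊗≫ 𝟙 _ := by monoidal
    _ = 𝟙 _ ⊗≫ η[H] ▷ H ⊗≫ H ◁ φ ⊗≫ (H ◁ ε[H] ≫ (β_ (𝟙_ S) H).inv) ⊗≫ 𝟙 _ := by
      rw [whisker_exchange, braiding_inv_tensorUnit_left]
      monoidal
    _ = 𝟙 _ ⊗≫ η[H] ▷ H ⊗≫ ((α_ (𝟙_ S) H (H ⊗ 𝟙_ S ⊗ 𝟙_ S)).inv ≫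
          assocXYZ φ (𝟙_ S ⊗ H) (𝟙_ S) (𝟙_ S)) ⊗≫ ε[H] ▷ H ⊗≫ 𝟙 _ := by
      rw [BraidedCategory.braiding_inv_naturality_right, assocXYZ_unit,
        BraidedCategory.braiding_tensor_right_inv, braiding_inv_tensorUnit_right]
      monoidal
    _ = 𝟙 _ ⊗≫ (η[H] ▷ (H ⊗ 𝟙_ S ⊗ 𝟙_ S) ≫ homMYZ μ[H] (𝟙_ S) (𝟙_ S)) ⊗≫
          assocXYZ φ (𝟙_ S) (H ⊗ 𝟙_ S) (𝟙_ S) ⊗≫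
          (homXNZ δ (𝟙_ S) μ[H] (𝟙_ S) ≫ ε[H] ▷ ((𝟙_ S ⊗ H) ⊗ 𝟙_ S)) ⊗≫ 𝟙 _ := by
      rw [e]
      monoidal
    _ = 𝟙 _ ⊗≫ (Δ[H] ≫ inv 𝒮[H] ▷ H) ⊗≫ (β_ H H).inv ⊗≫ (φ ≫ ε[H]) ▷ H ⊗≫
          leftMul d ⊗≫ 𝟙 _ := by
      rw [elem_homMYZ, MonObj.mul_one, homXNZ_counit, assocXYZ, braiding_inv_tensorUnit_right,
        leftMul]
      monoidal
    _ = 𝟙 _ ⊗≫ (Δ[H] ≫ inv 𝒮[H] ▷ H) ⊗≫ (H ◁ (φ ≫ ε[H]) ≫ (β_ (𝟙_ S) H).inv) ⊗≫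
          leftMul d ⊗≫ 𝟙 _ := by
      rw [BraidedCategory.braiding_inv_naturality_right]
      monoidal
    _ = 𝟙 _ ⊗≫ (Δ[H] ≫ inv 𝒮[H] ▷ H) ⊗≫ (H ◁ (φ ≫ ε[H]) ≫ leftMul d ▷ 𝟙_ S) ⊗≫ 𝟙 _ := by
      rw [braiding_inv_tensorUnit_left]
      monoidal
    _ = _ := by
      rw [whisker_exchange]
      monoidal

lemma pentagon_XNYP_counit (h : Pentagon γ₀ δ φ) :
    δ ≫ (β_ H H).hom = γ₀ ≫ leftMul (δ ≫ ε[H] ▷ H ≫ (λ_ H).hom) ▷ H := by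
  have e := congrArg (fun f => f.down.hom)
    (h (.inr (𝟙_ S)) (.inl (regMod H)) (.inr (𝟙_ S)) (.inl (regMod H)))
  replace e : homXNZ δ (𝟙_ S) μ[H] (𝟙_ S ⊗ H) ≫ homXYP (𝟙_ S ⊗ H) (𝟙_ S) μ[H] =
      H ◁ (𝟙 (𝟙_ S) ⊗ₘ homMYP γ₀ μ[H] (𝟙_ S) μ[H]) ≫ homXYP (𝟙_ S) (H ⊗ 𝟙_ S) μ[H] ≫
      (homXNZ δ (𝟙_ S) μ[H] (𝟙_ S) ⊗ₘ 𝟙 H) := e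
  simp only [id_tensorHom, tensorHom_id] at e
  set d := δ ≫ ε[H] ▷ H ≫ (λ_ H).hom with hd
  calc
    _ = 𝟙 _ ⊗≫ δ ⊗≫ (β_ H H).hom ▷ 𝟙_ S ⊗≫ H ◁ (H ◁ η[H] ≫ μ[H]) := by
      rw [MonObj.mul_one]
      monoidal
    _ = 𝟙 _ ⊗≫ δ ⊗≫ ((H ⊗ H) ◁ η[H] ≫ (β_ H H).hom ▷ H) ⊗≫ H ◁ μ[H] := by
      rw [whisker_exchange]
      monoidal
    _ = 𝟙 _ ⊗≫ δ ⊗≫ H ◁ (𝟙_ S ◁ (H ◁ η[H])) ⊗≫ (homXYP (𝟙_ S ⊗ H) (𝟙_ S) μ[H] ≫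
          ε[H] ▷ ((𝟙_ S ⊗ H) ⊗ 𝟙_ S) ▷ H) ⊗≫ 𝟙 _ := by
      rw [homXYP_counit, BraidedCategory.braiding_tensor_right_hom,
        BraidedCategory.braiding_tensor_right_hom, braiding_tensorUnit_right]
      monoidal
    _ = 𝟙 _ ⊗≫ δ ⊗≫ H ◁ (H ◁ η[H] ≫ μ[H]) ⊗≫ H ◁ H ◁ η[H] ⊗≫
          homXYP (𝟙_ S ⊗ H) (𝟙_ S) μ[H] ⊗≫ ε[H] ▷ (H ⊗ H) ⊗≫ 𝟙 _ := by
      rw [MonObj.mul_one]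
      monoidal
    _ = 𝟙 _ ⊗≫ δ ⊗≫ H ◁ H ◁ η[H] ⊗≫ H ◁ (μ[H] ▷ 𝟙_ S ≫ H ◁ η[H]) ⊗≫
          homXYP (𝟙_ S ⊗ H) (𝟙_ S) μ[H] ⊗≫ ε[H] ▷ (H ⊗ H) ⊗≫ 𝟙 _ := by
      monoidal
    _ = 𝟙 _ ⊗≫ (δ ▷ 𝟙_ S ≫ (H ⊗ H) ◁ η[H ⊗ H]) ⊗≫ H ◁ μ[H] ▷ H ⊗≫
          homXYP (𝟙_ S ⊗ H) (𝟙_ S) μ[H] ⊗≫ ε[H] ▷ (H ⊗ H) ⊗≫ 𝟙 _ := by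
      rw [← whisker_exchange, MonObj.tensorObj.one_def, MonoidalCategory.tensorHom_def]
      monoidal
    _ = 𝟙 _ ⊗≫ η[H ⊗ H] ⊗≫ (η[H] ▷ (𝟙_ S ⊗ (H ⊗ (𝟙_ S ⊗ H))) ≫
          homXNZ δ (𝟙_ S) μ[H] (𝟙_ S ⊗ H)) ⊗≫
          homXYP (𝟙_ S ⊗ H) (𝟙_ S) μ[H] ⊗≫ ε[H] ▷ (H ⊗ H) ⊗≫ 𝟙 _ := by
      rw [← whisker_exchange, one_homXNZ, tensorμ, braiding_tensorUnit_right]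
      monoidal
    _ = 𝟙 _ ⊗≫ η[H ⊗ H] ⊗≫ η[H] ▷ (H ⊗ H) ⊗≫ (homXNZ δ (𝟙_ S) μ[H] (𝟙_ S ⊗ H) ≫
          homXYP (𝟙_ S ⊗ H) (𝟙_ S) μ[H]) ⊗≫ ε[H] ▷ (H ⊗ H) ⊗≫ 𝟙 _ := by
      monoidal
    _ = 𝟙 _ ⊗≫ η[H ⊗ H] ⊗≫ (η[H] ▷ (H ⊗ (𝟙_ S ⊗ H)) ≫ H ◁ homMYP γ₀ μ[H] (𝟙_ S) μ[H]) ⊗≫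
          homXYP (𝟙_ S) (H ⊗ 𝟙_ S) μ[H] ⊗≫
          (homXNZ δ (𝟙_ S) μ[H] (𝟙_ S) ≫ ε[H] ▷ ((𝟙_ S ⊗ H) ⊗ 𝟙_ S)) ▷ H ⊗≫ 𝟙 _ := by
      rw [e]
      monoidal
    _ = 𝟙 _ ⊗≫ (η[H ⊗ H] ≫ H ◁ (λ_ H).inv ≫ homMYP γ₀ μ[H] (𝟙_ S) μ[H]) ⊗≫
          (η[H] ▷ (𝟙_ S ⊗ ((H ⊗ 𝟙_ S) ⊗ H)) ≫ homXYP (𝟙_ S) (H ⊗ 𝟙_ S) μ[H]) ⊗≫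
          (ε[H] ▷ H ⊗≫ leftMul d) ▷ H ⊗≫ 𝟙 _ := by
      rw [← whisker_exchange, homXNZ_counit, leftMul]
      monoidal
    _ = 𝟙 _ ⊗≫ γ₀ ⊗≫ (η[H] ≫ ε[H]) ▷ (H ⊗ H) ⊗≫ leftMul d ▷ H ⊗≫ 𝟙 _ := by
      rw [one_homMYP_regular, one_homXYP _ _ _ (MonObj.one_mul H)]
      monoidal
    _ = _ := by
      rw [BimonObj.one_counit]
      monoidal

lemma pentagon_XNPZ_counit (h : Pentagon γ₀ δ φ) :
    (δ ≫ ε[H] ▷ H ≫ (λ_ H).hom) ≫ Δ[H] = (λ_ (𝟙_ S)).inv ≫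
      ((δ ≫ ε[H] ▷ H ≫ (λ_ H).hom) ⊗ₘ (δ ≫ ε[H] ▷ H ≫ (λ_ H).hom)) := by
  have e := congrArg (fun f => f.down.hom)
    (h (.inr (𝟙_ S)) (.inl (regMod H)) (.inl (regMod H)) (.inr (𝟙_ S)))
  replace e : homXNZ δ (𝟙_ S) μ[H] (H ⊗ 𝟙_ S) ≫ homXNZ δ (𝟙_ S ⊗ H) μ[H] (𝟙_ S) =
      H ◁ (𝟙 (𝟙_ S) ⊗ₘ (α_ H H (𝟙_ S)).inv) ≫ homXNZ δ (𝟙_ S) (diagAct μ[H] μ[H]) (𝟙_ S) ≫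
      H ◁ ((α_ (𝟙_ S) H H).inv ⊗ₘ 𝟙 (𝟙_ S)) := e
  simp only [id_tensorHom, tensorHom_id] at e
  set d := δ ≫ ε[H] ▷ H ≫ (λ_ H).hom with hd
  calc
    _ = 𝟙 _ ⊗≫ d ⊗≫ (H ◁ η[H ⊗ H] ≫ diagAct μ[H] μ[H]) := by
      rw [one_diagAct_regular]
      monoidal
    _ = 𝟙 _ ⊗≫ (d ▷ 𝟙_ S ≫ H ◁ η[H ⊗ H]) ⊗≫ diagAct μ[H] μ[H] := by
      monoidal
    _ = 𝟙 _ ⊗≫ η[H ⊗ H] ⊗≫ (η[H] ≫ ε[H]) ▷ (H ⊗ H) ⊗≫ d ▷ (H ⊗ H) ⊗≫ diagAct μ[H] μ[H] := by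
      rw [← whisker_exchange, BimonObj.one_counit]
      monoidal
    _ = 𝟙 _ ⊗≫ η[H ⊗ H] ⊗≫ η[H] ▷ (H ⊗ H) ⊗≫ (H ◁ (𝟙_ S ◁ (α_ H H (𝟙_ S)).inv) ≫
          homXNZ δ (𝟙_ S) (diagAct μ[H] μ[H]) (𝟙_ S) ≫ ε[H] ▷ ((𝟙_ S ⊗ (H ⊗ H)) ⊗ 𝟙_ S)) ⊗≫
          𝟙 _ := by
      rw [homXNZ_counit]
      monoidal
    _ = 𝟙 _ ⊗≫ η[H ⊗ H] ⊗≫ η[H] ▷ (H ⊗ H) ⊗≫ (H ◁ (𝟙_ S ◁ (α_ H H (𝟙_ S)).inv) ≫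
          homXNZ δ (𝟙_ S) (diagAct μ[H] μ[H]) (𝟙_ S) ≫ H ◁ (α_ (𝟙_ S) H H).inv ▷ 𝟙_ S) ⊗≫
          ε[H] ▷ (H ⊗ H) ⊗≫ 𝟙 _ := by
      monoidal
    _ = 𝟙 _ ⊗≫ η[H ⊗ H] ⊗≫ η[H] ▷ (H ⊗ H) ⊗≫ homXNZ δ (𝟙_ S) μ[H] (H ⊗ 𝟙_ S) ⊗≫
          (homXNZ δ (𝟙_ S ⊗ H) μ[H] (𝟙_ S) ≫ ε[H] ▷ (((𝟙_ S ⊗ H) ⊗ H) ⊗ 𝟙_ S)) ⊗≫ 𝟙 _ := by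
      rw [← e]
      monoidal
    _ = 𝟙 _ ⊗≫ η[H ⊗ H] ⊗≫ η[H] ▷ (H ⊗ H) ⊗≫ (homXNZ δ (𝟙_ S) μ[H] (H ⊗ 𝟙_ S) ≫
          ε[H] ▷ ((𝟙_ S ⊗ H) ⊗ (H ⊗ 𝟙_ S))) ⊗≫ H ◁ leftMul d ⊗≫ 𝟙 _ := by
      rw [homXNZ_counit, leftMul]
      monoidal
    _ = 𝟙 _ ⊗≫ η[H ⊗ H] ⊗≫ (η[H] ≫ ε[H]) ▷ (H ⊗ H) ⊗≫ leftMul d ▷ H ⊗≫ H ◁ leftMul d := by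
      rw [homXNZ_counit]
      simp only [leftMul]
      monoidal
    _ = 𝟙 _ ⊗≫ η[H] ⊗≫ (H ◁ η[H] ≫ leftMul d ▷ H) ⊗≫ H ◁ leftMul d := by
      rw [BimonObj.one_counit, MonObj.tensorObj.one_def, MonoidalCategory.tensorHom_def]
      monoidal
    _ = 𝟙 _ ⊗≫ (η[H] ≫ leftMul d) ⊗≫ H ◁ (η[H] ≫ leftMul d) := by
      rw [whisker_exchange]
      monoidal
    _ = _ := by
      rw [one_leftMul, MonoidalCategory.tensorHom_def]
      monoidal

lemma pentagon_MYNZ (h : Pentagon γ₀ δ φ) :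
    δ ≫ H ◁ ((λ_ H).inv ≫ η[H] ▷ H) = δ ≫ (Δ[H] ≫ inv 𝒮[H] ▷ H ≫ (β_ H H).inv) ▷ H ≫
      (α_ _ _ _).hom ≫ H ◁ ((λ_ _).inv ≫ γ₀ ▷ (H ⊗ H) ≫ μ[H ⊗ H]) := by
  have e := congrArg (fun f => f.down.hom)
    (h (.inl (regMod H)) (.inr (𝟙_ S)) (.inl (regMod H)) (.inr (𝟙_ S)))
  replace e : homMYZ μ[H] (𝟙_ S) (H ⊗ 𝟙_ S) ≫ homXNZ δ (H ⊗ 𝟙_ S) μ[H] (𝟙_ S) =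
      (𝟙 H ⊗ₘ homXNZ δ (𝟙_ S) μ[H] (𝟙_ S)) ≫ homMYZ μ[H] (𝟙_ S ⊗ H) (𝟙_ S) ≫
      H ◁ (homMYP γ₀ μ[H] (𝟙_ S) μ[H] ⊗ₘ 𝟙 (𝟙_ S)) := e
  simp only [id_tensorHom, tensorHom_id] at e
  have hS : η[H] ≫ inv 𝒮[H] = η[H] := by
    rw [IsIso.comp_inv_eq, HopfObj.one_antipode]
  symm
  calc
    _ = 𝟙 _ ⊗≫ δ ⊗≫ (Δ[H] ≫ inv 𝒮[H] ▷ H ≫ (β_ H H).inv) ▷ H ⊗≫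
          H ◁ homMYP γ₀ μ[H] (𝟙_ S) μ[H] ⊗≫ 𝟙 _ := by
      rw [homMYP_regular]
      monoidal
    _ = 𝟙 _ ⊗≫ (η[H] ≫ (λ_ H).inv ≫ η[H] ▷ H ≫ H ◁ ((ρ_ H).inv ≫ (λ_ _).inv) ≫
          homXNZ δ (𝟙_ S) μ[H] (𝟙_ S)) ⊗≫
          (η[H] ▷ (H ⊗ ((𝟙_ S ⊗ H) ⊗ 𝟙_ S)) ≫ homMYZ μ[H] (𝟙_ S ⊗ H) (𝟙_ S)) ⊗≫
          H ◁ homMYP γ₀ μ[H] (𝟙_ S) μ[H] ⊗≫ 𝟙 _ := by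
      rw [one_homXNZ_regular, elem_homMYZ, MonObj.mul_one]
      monoidal
    _ = 𝟙 _ ⊗≫ η[H] ⊗≫ η[H] ▷ H ⊗≫ (𝟙_ S ◁ homXNZ δ (𝟙_ S) μ[H] (𝟙_ S) ≫
          η[H] ▷ (H ⊗ ((𝟙_ S ⊗ H) ⊗ 𝟙_ S))) ⊗≫ homMYZ μ[H] (𝟙_ S ⊗ H) (𝟙_ S) ⊗≫
          H ◁ homMYP γ₀ μ[H] (𝟙_ S) μ[H] ⊗≫ 𝟙 _ := by
      monoidal
    _ = 𝟙 _ ⊗≫ η[H] ⊗≫ η[H] ▷ H ⊗≫ η[H] ▷ (H ⊗ H) ⊗≫ (H ◁ homXNZ δ (𝟙_ S) μ[H] (𝟙_ S) ≫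
          homMYZ μ[H] (𝟙_ S ⊗ H) (𝟙_ S) ≫ H ◁ homMYP γ₀ μ[H] (𝟙_ S) μ[H] ▷ 𝟙_ S) ⊗≫ 𝟙 _ := by
      rw [whisker_exchange]
      monoidal
    _ = 𝟙 _ ⊗≫ η[H] ⊗≫ η[H] ▷ H ⊗≫ (η[H] ▷ (H ⊗ (𝟙_ S ⊗ (H ⊗ 𝟙_ S))) ≫
          homMYZ μ[H] (𝟙_ S) (H ⊗ 𝟙_ S)) ⊗≫ homXNZ δ (H ⊗ 𝟙_ S) μ[H] (𝟙_ S) ⊗≫ 𝟙 _ := by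
      rw [← e]
      monoidal
    _ = 𝟙 _ ⊗≫ η[H] ⊗≫ ((η[H] ≫ Δ[H]) ≫ inv 𝒮[H] ▷ H ≫ (β_ H H).inv) ▷ H ⊗≫
          homXNZ δ (H ⊗ 𝟙_ S) μ[H] (𝟙_ S) ⊗≫ 𝟙 _ := by
      rw [elem_homMYZ, MonObj.mul_one]
      monoidal
    _ = 𝟙 _ ⊗≫ η[H] ⊗≫ (η[H] ⊗≫ ((η[H] ≫ inv 𝒮[H]) ▷ H ≫ (β_ H H).inv)) ▷ H ⊗≫
          homXNZ δ (H ⊗ 𝟙_ S) μ[H] (𝟙_ S) ⊗≫ 𝟙 _ := by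
      rw [BimonObj.one_comul, MonObj.tensorObj.one_def, MonoidalCategory.tensorHom_def']
      monoidal
    _ = 𝟙 _ ⊗≫ η[H] ⊗≫ (η[H] ▷ 𝟙_ S ≫ H ◁ η[H]) ▷ H ⊗≫
          homXNZ δ (H ⊗ 𝟙_ S) μ[H] (𝟙_ S) ⊗≫ 𝟙 _ := by
      rw [hS, BraidedCategory.braiding_inv_naturality_left, braiding_inv_tensorUnit_right]
      monoidal
    _ = 𝟙 _ ⊗≫ η[H] ⊗≫ η[H] ▷ H ⊗≫ (η[H] ▷ ((H ⊗ 𝟙_ S) ⊗ (H ⊗ 𝟙_ S)) ≫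
          homXNZ δ (H ⊗ 𝟙_ S) μ[H] (𝟙_ S)) ⊗≫ 𝟙 _ := by
      rw [← whisker_exchange]
      monoidal
    _ = 𝟙 _ ⊗≫ (𝟙_ S ◁ (η[H] ⊗≫ η[H] ▷ H) ≫ δ ▷ (H ⊗ H)) ⊗≫ H ◁ (β_ H H).hom ▷ H ⊗≫
          (H ⊗ H) ◁ μ[H] ⊗≫ 𝟙 _ := by
      rw [one_homXNZ, tensorμ, BraidedCategory.braiding_tensor_right_hom,
        braiding_tensorUnit_right]
      monoidal
    _ = 𝟙 _ ⊗≫ δ ⊗≫ H ◁ H ◁ η[H] ⊗≫ H ◁ (H ◁ η[H] ≫ (β_ H H).hom) ▷ H ⊗≫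
          (H ⊗ H) ◁ μ[H] ⊗≫ 𝟙 _ := by
      rw [whisker_exchange]
      monoidal
    _ = 𝟙 _ ⊗≫ δ ⊗≫ H ◁ (𝟙_ S ◁ (H ◁ η[H]) ≫ η[H] ▷ (H ⊗ H)) ⊗≫
          (H ⊗ H) ◁ μ[H] ⊗≫ 𝟙 _ := by
      rw [BraidedCategory.braiding_naturality_right, braiding_tensorUnit_right]
      monoidal
    _ = 𝟙 _ ⊗≫ δ ⊗≫ H ◁ (η[H] ▷ H) ⊗≫ (H ⊗ H) ◁ (H ◁ η[H] ≫ μ[H]) ⊗≫ 𝟙 _ := by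
      rw [whisker_exchange]
      monoidal
    _ = _ := by
      rw [MonObj.mul_one]
      monoidal

end PentagonComponents

section Elements
variable {S : Type u} [Category.{v} S] [MonoidalCategory S] [BraidedCategory S]

/-- The product of two elements of an algebra. -/
def elemMul {A : S} [MonObj A] (x y : 𝟙_ S ⟶ A) : 𝟙_ S ⟶ A := (λ_ (𝟙_ S)).inv ≫ (x ⊗ₘ y) ≫ μ[A]

section
variable {A : S} [MonObj A]

lemma elemMul_eq_leftMul (x y : 𝟙_ S ⟶ A) : elemMul x y = y ≫ leftMul x := by
  rw [elemMul, leftMul, leftUnitor_inv_naturality_assoc, MonoidalCategory.tensorHom_def']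
  simp

lemma elemMul_eq_rightMul (x y : 𝟙_ S ⟶ A) : elemMul x y = x ≫ rightMul y := by
  rw [elemMul, rightMul, rightUnitor_inv_naturality_assoc, MonoidalCategory.tensorHom_def]
  simp [unitors_inv_equal]

lemma leftMul_comp (x y : 𝟙_ S ⟶ A) : leftMul x ≫ leftMul y = leftMul (elemMul y x) := by
  simp only [leftMul, elemMul]
  calc
    _ = 𝟙 _ ⊗≫ (𝟙_ S ◁ (x ▷ A ≫ μ[A]) ≫ y ▷ A) ⊗≫ μ[A] := by monoidal
    _ = 𝟙 _ ⊗≫ y ▷ A ⊗≫ A ◁ x ▷ A ⊗≫ ((α_ A A A).hom ≫ A ◁ μ[A] ≫ μ[A]) := by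
      rw [whisker_exchange]; monoidal
    _ = _ := by
      rw [← MonObj.mul_assoc, MonoidalCategory.tensorHom_def]; monoidal

lemma rightMul_comp (x y : 𝟙_ S ⟶ A) : rightMul x ≫ rightMul y = rightMul (elemMul x y) := by
  simp only [rightMul, elemMul]
  calc
    _ = 𝟙 _ ⊗≫ ((A ◁ x ≫ μ[A]) ▷ 𝟙_ S ≫ A ◁ y) ⊗≫ μ[A] := by monoidal
    _ = 𝟙 _ ⊗≫ A ◁ y ⊗≫ A ◁ x ▷ A ⊗≫ (μ[A] ▷ A ≫ μ[A]) := by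
      rw [← whisker_exchange]; monoidal
    _ = _ := by
      rw [MonObj.mul_assoc, MonoidalCategory.tensorHom_def']; monoidal

lemma leftMul_one : leftMul η[A] = 𝟙 A := by
  rw [leftMul, MonObj.one_mul, Iso.inv_hom_id]

lemma rightMul_one : rightMul η[A] = 𝟙 A := by
  rw [rightMul, MonObj.mul_one, Iso.inv_hom_id]

lemma one_rightMul (x : 𝟙_ S ⟶ A) : η[A] ≫ rightMul x = x := by
  rw [← elemMul_eq_rightMul, elemMul_eq_leftMul, leftMul_one, Category.comp_id]

lemma elemMul_assoc (x y z : 𝟙_ S ⟶ A) :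
    elemMul (elemMul x y) z = elemMul x (elemMul y z) := by
  rw [elemMul_eq_leftMul, ← leftMul_comp, ← Category.assoc, ← elemMul_eq_leftMul,
    ← elemMul_eq_leftMul]

lemma one_elemMul (x : 𝟙_ S ⟶ A) : elemMul η[A] x = x := by
  rw [elemMul_eq_leftMul, leftMul_one, Category.comp_id]

lemma elemMul_one (x : 𝟙_ S ⟶ A) : elemMul x η[A] = x := by
  rw [elemMul_eq_rightMul, rightMul_one, Category.comp_id]

lemma IsMulInv.eq_of_elemMul {x y z w : 𝟙_ S ⟶ A} (h : IsMulInv x y) (hw : elemMul x z = w) :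
    z = elemMul y w := by
  rw [← hw, ← elemMul_assoc, show elemMul y x = η[A] from h.2, one_elemMul]

lemma IsMulInv.eq_one_of_elemMul_self {x y z : 𝟙_ S ⟶ A} (h : IsMulInv x y)
    (hz : elemMul z x = x) : z = η[A] := by
  have := congrArg (elemMul · y) hz
  simp only [elemMul_assoc, show elemMul x y = η[A] from h.1, elemMul_one] at this
  exact this

lemma IsMulInv.eq_one_of_self_elemMul {x y z : 𝟙_ S ⟶ A} (h : IsMulInv x y)
    (hz : elemMul x z = x) : z = η[A] := by
  rw [h.eq_of_elemMul hz, show elemMul y x = η[A] from h.2]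

end

variable {H : S} [HopfObj H]

lemma leftMul_antipode (d : 𝟙_ S ⟶ H) :
    leftMul d ≫ 𝒮[H] = 𝒮[H] ≫ rightMul (d ≫ 𝒮[H]) := by
  calc
    _ = 𝟙 _ ⊗≫ (𝟙_ S ◁ 𝒮[H] ≫ d ▷ H) ⊗≫ 𝒮[H] ▷ H ⊗≫ (β_ H H).hom ⊗≫ μ[H] := by
      rw [leftMul, Category.assoc, Category.assoc, HopfObj.mul_antipode,
        MonoidalCategory.tensorHom_def', Category.assoc, ← whisker_exchange_assoc]
      monoidal
    _ = 𝒮[H] ⊗≫ ((d ≫ 𝒮[H]) ▷ H ≫ (β_ H H).hom) ⊗≫ μ[H] := by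
      monoidal
    _ = _ := by
      rw [braiding_elem, rightMul]
      monoidal

lemma leftMul_counit (d : 𝟙_ S ⟶ H) : leftMul d ≫ ε[H] = ε[H] ≫ d ≫ ε[H] := by
  rw [leftMul, Category.assoc, Category.assoc, mul_counit_eq]
  calc
    _ = 𝟙 _ ⊗≫ (d ≫ ε[H]) ▷ H ⊗≫ ε[H] := by monoidal
    _ = 𝟙 _ ⊗≫ ((d ≫ ε[H]) ▷ H ≫ 𝟙_ S ◁ ε[H]) ⊗≫ 𝟙 _ := by monoidal
    _ = _ := by rw [← whisker_exchange]; monoidal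

lemma IsGroupLike.isMulInv {d : 𝟙_ S ⟶ H} (h : IsGroupLike d) : IsMulInv d (d ≫ 𝒮[H]) := by
  constructor
  · calc
      _ = ((λ_ (𝟙_ S)).inv ≫ (d ⊗ₘ d)) ≫ H ◁ 𝒮[H] ≫ μ[H] := by
        simp [MonoidalCategory.tensorHom_def]
      _ = _ := by
        rw [← h.1, Category.assoc, HopfObj.antipode_right, reassoc_of% h.2]
  · calc
      _ = ((λ_ (𝟙_ S)).inv ≫ (d ⊗ₘ d)) ≫ 𝒮[H] ▷ H ≫ μ[H] := by
        simp [MonoidalCategory.tensorHom_def']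
      _ = _ := by
        rw [← h.1, Category.assoc, HopfObj.antipode_left, reassoc_of% h.2]

/-- `(x ⊗ 1) ↦ x (1 ⊗ d)` multiplies the second factor. -/
lemma elemMul_one_tensor (x : 𝟙_ S ⟶ H ⊗ H) (d : 𝟙_ S ⟶ H) :
    elemMul x ((λ_ (𝟙_ S)).inv ≫ (η[H] ⊗ₘ d)) = x ≫ H ◁ rightMul d := by
  rw [elemMul_eq_rightMul]
  congr 1
  have h := tensorμ_natural_right H H η[H] d
  rw [rightMul, MonObj.tensorObj.mul_def, whiskerLeft_comp_assoc, reassoc_of% h,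
    tensorHom_comp_tensorHom, MonObj.mul_one, rightMul, tensorμ, braiding_tensorUnit_right,
    MonoidalCategory.tensorHom_def]
  monoidal

section Convolution
variable {γ₀ : 𝟙_ S ⟶ H ⊗ H}

lemma comul_left_conv
    (E2 : γ₀ ≫ Δ[H] ▷ H = (λ_ (𝟙_ S)).inv ≫ (γ₀ ⊗ₘ γ₀) ≫ tensorμ H H H H ≫ (H ⊗ H) ◁ μ[H])
    (f g : H ⟶ H) :
    γ₀ ≫ (Δ[H] ≫ (f ⊗ₘ g) ≫ μ[H]) ▷ H = elemMul (γ₀ ≫ f ▷ H) (γ₀ ≫ g ▷ H) := by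
  have h := tensorμ_natural (f) (𝟙 H) g (𝟙 H)
  rw [comp_whiskerRight, reassoc_of% E2, elemMul, MonObj.tensorObj.mul_def]
  rw [← tensorHom_comp_tensorHom, Category.assoc, ← tensorHom_id, ← tensorHom_id, ← tensorHom_id,
    reassoc_of% h, ← id_tensorHom, tensorHom_comp_tensorHom, tensorHom_comp_tensorHom,
    id_tensorHom_id, Category.id_comp, Category.id_comp, Category.comp_id]

lemma comul_right_conv
    (E1 : γ₀ ≫ H ◁ Δ[H] = (λ_ (𝟙_ S)).inv ≫ (γ₀ ⊗ₘ γ₀) ≫ tensorμ H H H H ≫ μ[H] ▷ (H ⊗ H))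
    (f g : H ⟶ H) :
    γ₀ ≫ H ◁ (Δ[H] ≫ (f ⊗ₘ g) ≫ μ[H]) = elemMul (γ₀ ≫ H ◁ f) (γ₀ ≫ H ◁ g) := by
  have h := tensorμ_natural (𝟙 H) f (𝟙 H) g
  rw [whiskerLeft_comp, reassoc_of% E1, elemMul, MonObj.tensorObj.mul_def]
  rw [← tensorHom_comp_tensorHom, Category.assoc, ← id_tensorHom, ← id_tensorHom, ← id_tensorHom,
    reassoc_of% h, ← tensorHom_id, tensorHom_comp_tensorHom, tensorHom_comp_tensorHom,
    id_tensorHom_id, Category.id_comp, Category.id_comp, Category.comp_id]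

end Convolution
end Elements

section Snake
variable {S : Type u} [Category.{v} S] [MonoidalCategory S] [BraidedCategory S]
  [RightRigidCategory S]

/-- The morphism `Xᘁ ⟶ Y` given by an element of `X ⊗ Y`. -/
def capElem {X Y : S} (x : 𝟙_ S ⟶ X ⊗ Y) : dual X ⟶ Y :=
  (ρ_ (dual X)).inv ≫ dual X ◁ x ≫ (α_ (dual X) X Y).inv ≫ ε_ X (dual X) ▷ Y ≫ (λ_ Y).hom

lemma coev_capElem {X Y : S} (x : 𝟙_ S ⟶ X ⊗ Y) : η_ X (dual X) ≫ X ◁ capElem x = x := by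
  calc
    _ = 𝟙 _ ⊗≫ (η_ X (dual X) ▷ 𝟙_ S ≫ (X ⊗ dual X) ◁ x) ⊗≫ X ◁ ε_ X (dual X) ▷ Y ⊗≫ 𝟙 _ := by
      rw [capElem]; monoidal
    _ = x ⊗≫ (η_ X (dual X) ▷ X ≫ (α_ _ _ _).hom ≫ X ◁ ε_ X (dual X)) ▷ Y ⊗≫ 𝟙 _ := by
      rw [← whisker_exchange]; monoidal
    _ = _ := by
      rw [ExactPairing.evaluation_coevaluation]; monoidal

lemma capElem_coev {X Y : S} (k : dual X ⟶ Y) : capElem (η_ X (dual X) ≫ X ◁ k) = k := by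
  calc
    _ = 𝟙 _ ⊗≫ dual X ◁ η_ X (dual X) ⊗≫ ((dual X ⊗ X) ◁ k ≫ ε_ X (dual X) ▷ Y) ⊗≫ 𝟙 _ := by
      rw [capElem]; monoidal
    _ = 𝟙 _ ⊗≫ (dual X ◁ η_ X (dual X) ≫ (α_ _ _ _).inv ≫ ε_ X (dual X) ▷ dual X) ⊗≫ k := by
      rw [whisker_exchange]; monoidal
    _ = _ := by
      rw [ExactPairing.coevaluation_evaluation]; monoidal

lemma dual_hom_ext {X Y : S} {k l : dual X ⟶ Y}
    (h : η_ X (dual X) ≫ X ◁ k = η_ X (dual X) ≫ X ◁ l) :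
    k = l := by
  rw [← capElem_coev k, h, capElem_coev]

lemma capElem_comp {X Y Z : S} (x : 𝟙_ S ⟶ X ⊗ Y) (f : Y ⟶ Z) :
    capElem x ≫ f = capElem (x ≫ X ◁ f) := by
  apply dual_hom_ext
  rw [coev_capElem, whiskerLeft_comp, ← Category.assoc, coev_capElem]

lemma hom_dual_ext {X Y : S} {k l : Y ⟶ dual X}
    (h : k ▷ X ≫ ε_ X (dual X) = l ▷ X ≫ ε_ X (dual X)) :
    k = l := by
  have key (k : Y ⟶ dual X) :
      𝟙 _ ⊗≫ Y ◁ η_ X (dual X) ⊗≫ (k ▷ X ≫ ε_ X (dual X)) ▷ dual X ⊗≫ 𝟙 _ = k := by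
    calc
      _ = 𝟙 _ ⊗≫ (Y ◁ η_ X (dual X) ≫ k ▷ (X ⊗ dual X)) ⊗≫ ε_ X (dual X) ▷ dual X ⊗≫
            𝟙 _ := by monoidal
      _ = k ⊗≫ (dual X ◁ η_ X (dual X) ≫ (α_ _ _ _).inv ≫ ε_ X (dual X) ▷ dual X) ⊗≫ 𝟙 _ := by
        rw [whisker_exchange]; monoidal
      _ = _ := by
        rw [ExactPairing.coevaluation_evaluation]; monoidal
  rw [← key k, h, key l]

/-- If `x` is a one-sided inverse of a pairing, then `Xᘁ ⟶ Y` is a split monomorphism. -/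
lemma capElem_retract {X Y : S} (x : 𝟙_ S ⟶ X ⊗ Y) (p : Y ⊗ X ⟶ 𝟙_ S)
    (h : (λ_ X).inv ≫ x ▷ X ≫ (α_ _ _ _).hom ≫ X ◁ p ≫ (ρ_ X).hom = 𝟙 X) :
    ∃ r, capElem x ≫ r = 𝟙 _ := by
  refine ⟨(ρ_ Y).inv ≫ Y ◁ η_ X (dual X) ≫ (α_ _ _ _).inv ≫ p ▷ dual X ≫ (λ_ _).hom, ?_⟩
  calc
    _ = 𝟙 _ ⊗≫ (capElem x ▷ 𝟙_ S ≫ Y ◁ η_ X (dual X)) ⊗≫ p ▷ dual X ⊗≫ 𝟙 _ := by monoidal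
    _ = 𝟙 _ ⊗≫ dual X ◁ η_ X (dual X) ⊗≫ dual X ◁ x ▷ X ▷ dual X ⊗≫
          (ε_ X (dual X) ▷ (Y ⊗ X) ≫ 𝟙_ S ◁ p) ▷ dual X ⊗≫
          𝟙 _ := by
      rw [← whisker_exchange, capElem]; monoidal
    _ = 𝟙 _ ⊗≫ dual X ◁ η_ X (dual X) ⊗≫ dual X ◁ ((λ_ X).inv ≫ x ▷ X ≫ (α_ _ _ _).hom ≫ X ◁ p ≫
          (ρ_ X).hom) ▷ dual X ⊗≫ ε_ X (dual X) ▷ dual X ⊗≫ 𝟙 _ := by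
      rw [← whisker_exchange]; monoidal
    _ = 𝟙 _ ⊗≫ (dual X ◁ η_ X (dual X) ≫ (α_ _ _ _).inv ≫ ε_ X (dual X) ▷ dual X) ⊗≫ 𝟙 _ := by
      rw [h]; monoidal
    _ = _ := by
      rw [ExactPairing.coevaluation_evaluation]; monoidal

lemma capElem_section {X Y Z : S} (x : 𝟙_ S ⟶ X ⊗ Y) (q : Z ⊗ X ⟶ 𝟙_ S) :
    ((ρ_ Z).inv ≫ Z ◁ η_ X (dual X) ≫ (α_ _ _ _).inv ≫ q ▷ dual X ≫ (λ_ _).hom) ≫ capElem x =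
      (ρ_ Z).inv ≫ Z ◁ x ≫ (α_ _ _ _).inv ≫ q ▷ Y ≫ (λ_ _).hom := by
  calc
    _ = 𝟙 _ ⊗≫ Z ◁ η_ X (dual X) ⊗≫ (q ▷ dual X ≫ 𝟙_ S ◁ capElem x) ⊗≫ 𝟙 _ := by monoidal
    _ = 𝟙 _ ⊗≫ Z ◁ (η_ X (dual X) ≫ X ◁ capElem x) ⊗≫ q ▷ Y ⊗≫ 𝟙 _ := by
      rw [← whisker_exchange]; monoidal
    _ = _ := by rw [coev_capElem]; monoidal

/-- Pulling the strand `Z` to the other side of an element of `X ⊗ Y`. -/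
lemma elem_pull {X Y Z : S} (x : 𝟙_ S ⟶ X ⊗ Y) (p : X ⊗ Z ⟶ 𝟙_ S) :
    (ρ_ Z).inv ≫ Z ◁ x ≫ (α_ _ _ _).inv ≫ ((β_ X Z).inv ≫ p) ▷ Y ≫ (λ_ _).hom =
      (λ_ Z).inv ≫ (x ≫ (β_ Y X).inv) ▷ Z ≫ (α_ _ _ _).hom ≫ Y ◁ p ≫ (ρ_ _).hom := by
  calc
    _ = 𝟙 _ ⊗≫ Z ◁ x ⊗≫ (β_ X Z).inv ▷ Y ⊗≫ (p ▷ Y ≫ (β_ Y (𝟙_ S)).inv) ⊗≫ 𝟙 _ := by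
      rw [braiding_inv_tensorUnit_right]; monoidal
    _ = 𝟙 _ ⊗≫ (Z ◁ x ≫ (β_ (X ⊗ Y) Z).inv) ⊗≫ (β_ Y X).inv ▷ Z ⊗≫ Y ◁ p ⊗≫ 𝟙 _ := by
      rw [BraidedCategory.braiding_inv_naturality_left, BraidedCategory.braiding_tensor_right_inv,
        BraidedCategory.braiding_tensor_left_inv]
      monoidal
    _ = _ := by
      rw [BraidedCategory.braiding_inv_naturality_right, braiding_inv_tensorUnit_left]
      monoidal

lemma drinfeld_ev (X : S) :
    drinfeld X ▷ dual X ≫ ε_ (dual X) (dual (dual X)) = (β_ X (dual X)).hom ≫ ε_ X (dual X) := by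
  calc
    _ = 𝟙 _ ⊗≫ X ◁ η_ (dual X) (dual (dual X)) ▷ dual X ⊗≫
          ((β_ X (dual X)).hom ≫ ε_ X (dual X)) ▷ (dual (dual X) ⊗ dual X) ⊗≫
          𝟙_ S ◁ ε_ (dual X) (dual (dual X)) ⊗≫ 𝟙 _ := by
      rw [drinfeld]; monoidal
    _ = 𝟙 _ ⊗≫ X ◁ η_ (dual X) (dual (dual X)) ▷ dual X ⊗≫
          (((β_ X (dual X)).hom ≫ ε_ X (dual X)) ▷ (dual (dual X) ⊗ dual X) ≫
          𝟙_ S ◁ ε_ (dual X) (dual (dual X))) ⊗≫ 𝟙 _ := by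
      monoidal
    _ = 𝟙 _ ⊗≫ X ◁ (η_ (dual X) (dual (dual X)) ▷ dual X ≫ (α_ _ _ _).hom ≫
          dual X ◁ ε_ (dual X) (dual (dual X))) ⊗≫
          ((β_ X (dual X)).hom ≫ ε_ X (dual X)) := by
      rw [← whisker_exchange]; monoidal
    _ = _ := by
      rw [ExactPairing.evaluation_coevaluation]; monoidal

lemma capElem_braiding_ev {X : S} (z : 𝟙_ S ⟶ X ⊗ X) :
    capElem z ▷ dual X ≫ (β_ X (dual X)).hom ≫ ε_ X (dual X) =
      dual X ◁ capElem (z ≫ (β_ X X).hom) ≫ ε_ X (dual X) := by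
  set V := dual X with hV
  symm
  calc
    _ = 𝟙 _ ⊗≫ V ◁ (V ◁ z ⊗≫ V ◁ (β_ X X).hom ⊗≫ (ε_ X V ▷ X ≫ (β_ X (𝟙_ S)).inv)) ⊗≫
          ε_ X V := by
      rw [capElem, braiding_inv_tensorUnit_right]; monoidal
    _ = 𝟙 _ ⊗≫ V ◁ (V ◁ z ⊗≫ V ◁ ((β_ X X).hom ≫ (β_ X X).inv) ⊗≫ (β_ X V).inv ▷ X ⊗≫
          X ◁ ε_ X V) ⊗≫ ε_ X V := by
      rw [BraidedCategory.braiding_inv_naturality_left, BraidedCategory.braiding_tensor_right_inv]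
      monoidal
    _ = 𝟙 _ ⊗≫ V ◁ (V ◁ z ⊗≫ (β_ X V).inv ▷ X) ⊗≫ ((V ⊗ X) ◁ ε_ X V ≫ ε_ X V ▷ 𝟙_ S) ⊗≫
          𝟙 _ := by
      rw [Iso.hom_inv_id]; monoidal
    _ = 𝟙 _ ⊗≫ V ◁ (V ◁ z ⊗≫ (β_ X V).inv ▷ X) ⊗≫ ε_ X V ▷ (V ⊗ X) ⊗≫
          ((β_ X V).inv ≫ (β_ X V).hom) ⊗≫ ε_ X V := by
      rw [whisker_exchange, Iso.inv_hom_id]; monoidal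
    _ = 𝟙 _ ⊗≫ V ◁ (V ◁ z ⊗≫ (β_ X V).inv ▷ X) ⊗≫ (ε_ X V ▷ (V ⊗ X) ≫ 𝟙_ S ◁ (β_ X V).inv) ⊗≫
          (β_ X V).hom ⊗≫ ε_ X V := by
      monoidal
    _ = 𝟙 _ ⊗≫ V ◁ (V ◁ z ≫ (β_ (X ⊗ X) V).inv) ⊗≫ ε_ X V ▷ (X ⊗ V) ⊗≫
          (β_ X V).hom ⊗≫ ε_ X V := by
      rw [← whisker_exchange, BraidedCategory.braiding_tensor_left_inv]; monoidal
    _ = _ := by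
      rw [BraidedCategory.braiding_inv_naturality_right, braiding_inv_tensorUnit_left, capElem]
      monoidal

end Snake

section Copairing
variable {S : Type u} [Category.{v} S] [MonoidalCategory S] [BraidedCategory S]
variable {H : S} [HopfObj H]

/-- `(ε ⊗ id) x` for an element `x` of `H ⊗ H`. -/
def counitLeft (x : 𝟙_ S ⟶ H ⊗ H) : 𝟙_ S ⟶ H := x ≫ ε[H] ▷ H ≫ (λ_ H).hom

lemma counit_conv (g : H ⟶ H) : Δ[H] ≫ ((ε[H] ≫ η[H]) ⊗ₘ g) ≫ μ[H] = g := by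
  have : ((ε[H] ≫ η[H]) ⊗ₘ g) ≫ μ[H] = ε[H] ▷ H ≫ (λ_ H).hom ≫ g := by
    rw [MonoidalCategory.tensorHom_def, comp_whiskerRight, Category.assoc, Category.assoc,
      ← whisker_exchange_assoc, MonObj.one_mul]
    simp
  rw [this, ComonObj.counit_comul_assoc, Iso.inv_hom_id_assoc]

lemma conv_counit (g : H ⟶ H) : Δ[H] ≫ (g ⊗ₘ (ε[H] ≫ η[H])) ≫ μ[H] = g := by
  have : (g ⊗ₘ (ε[H] ≫ η[H])) ≫ μ[H] = H ◁ ε[H] ≫ (ρ_ H).hom ≫ g := by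
    rw [MonoidalCategory.tensorHom_def', MonoidalCategory.whiskerLeft_comp, Category.assoc,
      Category.assoc, whisker_exchange_assoc, MonObj.mul_one]
    simp
  rw [this, ComonObj.comul_counit_assoc, Iso.inv_hom_id_assoc]

lemma one_tensor_counit_left : η[H ⊗ H] ≫ ε[H] ▷ H ≫ (λ_ H).hom = η[H] := by
  rw [MonObj.tensorObj.one_def, Category.assoc, MonoidalCategory.tensorHom_def', Category.assoc,
    ← comp_whiskerRight_assoc, BimonObj.one_counit]
  simp

lemma one_tensor_counit_right : η[H ⊗ H] ≫ H ◁ ε[H] ≫ (ρ_ H).hom = η[H] := by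
  rw [MonObj.tensorObj.one_def, Category.assoc, MonoidalCategory.tensorHom_def, Category.assoc,
    ← MonoidalCategory.whiskerLeft_comp_assoc, BimonObj.one_counit]
  simp [unitors_inv_equal]

variable [IsIso 𝒮[H]] {γ₀ δ : 𝟙_ S ⟶ H ⊗ H} {φ : H ⟶ H}

lemma copairing_counit_one_left (h : Pentagon γ₀ δ φ) (hγ : HasMulInv γ₀) :
    γ₀ ≫ (ε[H] ≫ η[H]) ▷ H = η[H ⊗ H] := by
  obtain ⟨y, hy⟩ := hγ
  have e := comul_left_conv (pentagon_MNYP h) (ε[H] ≫ η[H]) (𝟙 H)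
  rw [counit_conv, id_whiskerRight, Category.comp_id] at e
  exact hy.eq_one_of_elemMul_self e.symm

lemma copairing_one_counit_right (h : Pentagon γ₀ δ φ) (hγ : HasMulInv γ₀) :
    γ₀ ≫ H ◁ (ε[H] ≫ η[H]) = η[H ⊗ H] := by
  obtain ⟨y, hy⟩ := hγ
  have e := comul_right_conv (pentagon_MYNP h) (𝟙 H) (ε[H] ≫ η[H])
  rw [conv_counit, MonoidalCategory.whiskerLeft_id, Category.comp_id] at e
  exact hy.eq_one_of_self_elemMul e.symm

lemma copairing_counit_left (h : Pentagon γ₀ δ φ) (hγ : HasMulInv γ₀) :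
    counitLeft γ₀ = η[H] := by
  have e := congrArg (· ≫ ε[H] ▷ H ≫ (λ_ H).hom) (copairing_counit_one_left h hγ)
  simp only [one_tensor_counit_left, Category.assoc] at e
  rwa [← comp_whiskerRight_assoc, Category.assoc, BimonObj.one_counit, Category.comp_id] at e

lemma copairing_counit_right (h : Pentagon γ₀ δ φ) (hγ : HasMulInv γ₀) :
    γ₀ ≫ H ◁ ε[H] ≫ (ρ_ H).hom = η[H] := by
  have e := congrArg (· ≫ H ◁ ε[H] ≫ (ρ_ H).hom) (copairing_one_counit_right h hγ)
  simp only [one_tensor_counit_right, Category.assoc] at e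
  rwa [← MonoidalCategory.whiskerLeft_comp_assoc, Category.assoc, BimonObj.one_counit,
    Category.comp_id] at e

lemma copairing_isMulInv (h : Pentagon γ₀ δ φ) (hγ : HasMulInv γ₀) :
    IsMulInv γ₀ (γ₀ ≫ H ◁ 𝒮[H]) := by
  obtain ⟨y, hy⟩ := id hγ
  have e := comul_right_conv (pentagon_MYNP h) (𝟙 H) 𝒮[H]
  rw [id_tensorHom, HopfObj.antipode_right, MonoidalCategory.whiskerLeft_id, Category.comp_id,
    copairing_one_counit_right h hγ] at e
  rwa [hy.eq_of_elemMul e.symm, elemMul_one]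

lemma copairing_antipode (h : Pentagon γ₀ δ φ) (hγ : HasMulInv γ₀) :
    γ₀ ≫ 𝒮[H] ▷ H = γ₀ ≫ H ◁ 𝒮[H] := by
  have e := comul_left_conv (pentagon_MNYP h) (𝟙 H) 𝒮[H]
  rw [id_tensorHom, HopfObj.antipode_right, id_whiskerRight, Category.comp_id,
    copairing_counit_one_left h hγ] at e
  rw [(copairing_isMulInv h hγ).eq_of_elemMul e.symm, elemMul_one]

lemma elemMul_copairing (h : Pentagon γ₀ δ φ) :
    elemMul γ₀ (δ ≫ inv 𝒮[H] ▷ H) =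
      (λ_ (𝟙_ S)).inv ≫ (η[H] ⊗ₘ counitLeft δ) := by
  have e := congrArg (· ≫ ε[H] ▷ (H ⊗ H) ≫ (λ_ (H ⊗ H)).hom) (pentagon_MYNZ h)
  have hη : (λ_ (𝟙_ S)).inv ≫ (η[H] ⊗ₘ counitLeft δ) =
      δ ≫ H ◁ ((λ_ H).inv ≫ η[H] ▷ H) ≫ ε[H] ▷ (H ⊗ H) ≫ (λ_ (H ⊗ H)).hom := by
    rw [whisker_exchange_assoc, MonoidalCategory.tensorHom_def', counitLeft]
    monoidal
  have hc : Δ[H] ≫ inv 𝒮[H] ▷ H ≫ (β_ H H).inv ≫ ε[H] ▷ H = inv 𝒮[H] ≫ (λ_ H).inv := by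
    rw [← BraidedCategory.braiding_inv_naturality_right, braiding_inv_tensorUnit_left,
      ← whisker_exchange_assoc, ComonObj.comul_counit_assoc]
    monoidal
  simp only [Category.assoc] at e
  rw [hη, e, elemMul_eq_leftMul, leftMul]
  calc
    _ = 𝟙 _ ⊗≫ δ ⊗≫ (inv 𝒮[H] ≫ (λ_ H).inv) ▷ H ⊗≫ γ₀ ▷ (H ⊗ H) ⊗≫ μ[H ⊗ H] := by
      monoidal
    _ = 𝟙 _ ⊗≫ δ ⊗≫ (Δ[H] ≫ inv 𝒮[H] ▷ H ≫ (β_ H H).inv) ▷ H ⊗≫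
        (ε[H] ▷ (H ⊗ H) ≫ 𝟙_ S ◁ ((λ_ _).inv ≫ γ₀ ▷ (H ⊗ H) ≫ μ[H ⊗ H])) ⊗≫ 𝟙 _ := by
      rw [← hc]; monoidal
    _ = _ := by
      rw [← whisker_exchange]; monoidal

lemma delta_antipode (h : Pentagon γ₀ δ φ) (hγ : HasMulInv γ₀) :
    δ ≫ inv 𝒮[H] ▷ H = γ₀ ≫ H ◁ (𝒮[H] ≫ rightMul (counitLeft δ)) := by
  rw [(copairing_isMulInv h hγ).eq_of_elemMul (elemMul_copairing h), elemMul_one_tensor,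
    Category.assoc, MonoidalCategory.whiskerLeft_comp]

lemma delta_eq (h : Pentagon γ₀ δ φ) (hγ : HasMulInv γ₀) :
    δ = γ₀ ≫ 𝒮[H] ▷ H ≫ H ◁ (𝒮[H] ≫ rightMul (counitLeft δ)) := by
  rw [← whisker_exchange, ← Category.assoc, ← delta_antipode h hγ, Category.assoc,
    ← comp_whiskerRight, IsIso.inv_hom_id]
  simp

lemma conv_functional (h : Pentagon γ₀ δ φ) :
    Δ[H] ≫ (inv 𝒮[H] ≫ leftMul (counitLeft δ)) ▷ H ≫ H ◁ (φ ≫ ε[H]) ≫ (ρ_ H).hom =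
      φ ≫ ε[H] ≫ η[H] :=
  pentagon_XNYZ_counit h

lemma counitLeft_delta_counit [IsIso φ] (h : Pentagon γ₀ δ φ) :
    counitLeft δ ≫ ε[H] = 𝟙 (𝟙_ S) := by
  have e := congrArg (· ≫ ε[H]) (conv_functional h)
  simp only [Category.assoc, BimonObj.one_counit, Category.comp_id] at e
  have e' : Δ[H] ≫ (inv 𝒮[H] ≫ leftMul (counitLeft δ)) ▷ H ≫ H ◁ (φ ≫ ε[H]) ≫ (ρ_ H).hom ≫ ε[H] =
      φ ≫ ε[H] ≫ counitLeft δ ≫ ε[H] := by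
    have hd : (inv 𝒮[H] ≫ leftMul (counitLeft δ)) ≫ ε[H] = ε[H] ≫ counitLeft δ ≫ ε[H] := by
      have hS : inv 𝒮[H] ≫ ε[H] = ε[H] := by rw [IsIso.inv_comp_eq, HopfObj.antipode_counit]
      rw [Category.assoc, leftMul_counit, reassoc_of% hS]
    calc
      _ = Δ[H] ≫ H ◁ (φ ≫ ε[H]) ≫ (ρ_ H).hom ≫
          ((inv 𝒮[H] ≫ leftMul (counitLeft δ)) ≫ ε[H]) := by
        rw [← whisker_exchange_assoc]
        monoidal
      _ = 𝟙 _ ⊗≫ Δ[H] ⊗≫ (H ◁ (φ ≫ ε[H]) ≫ ε[H] ▷ 𝟙_ S) ⊗≫ counitLeft δ ≫ ε[H] := by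
        rw [hd]; monoidal
      _ = (Δ[H] ≫ ε[H] ▷ H) ⊗≫ (φ ≫ ε[H]) ⊗≫ counitLeft δ ≫ ε[H] := by
        rw [whisker_exchange]; monoidal
      _ = _ := by
        rw [ComonObj.counit_comul]; monoidal
  rw [e'] at e
  have := congrArg (fun f => η[H] ≫ inv φ ≫ f) e
  simp only [IsIso.inv_hom_id_assoc, BimonObj.one_counit, BimonObj.one_counit_assoc] at this
  exact this

end Copairing

section Distinguished
variable {S : Type u} [Category.{v} S] [MonoidalCategory S] [BraidedCategory S]
variable {H : S} [HopfObj H] [IsIso 𝒮[H]] {γ₀ δ : 𝟙_ S ⟶ H ⊗ H} {φ : H ⟶ H}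

lemma counitLeft_delta_isGroupLike [IsIso φ] (h : Pentagon γ₀ δ φ) : IsGroupLike (counitLeft δ) :=
  ⟨pentagon_XNPZ_counit h, counitLeft_delta_counit h⟩

lemma counitLeft_delta_isDistinguished [IsIso φ] (h : Pentagon γ₀ δ φ) :
    IsDistinguished (φ ≫ ε[H]) (counitLeft δ) := by
  have hd := (counitLeft_delta_isGroupLike h).isMulInv
  have e := congrArg (· ≫ 𝒮[H] ≫ rightMul (counitLeft δ)) (conv_functional h)
  simp only [Category.assoc, HopfObj.one_antipode_assoc, one_rightMul] at e
  have hf : (inv 𝒮[H] ≫ leftMul (counitLeft δ)) ≫ 𝒮[H] ≫ rightMul (counitLeft δ) = 𝟙 H := by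
    rw [Category.assoc, reassoc_of% (leftMul_antipode (counitLeft δ)), rightMul_comp,
      show elemMul (counitLeft δ ≫ 𝒮[H]) (counitLeft δ) = η[H] from hd.2, rightMul_one]
    simp
  rw [IsDistinguished, Category.assoc, ← e]
  calc
    _ = Δ[H] ≫ H ◁ (φ ≫ ε[H]) ≫ (ρ_ H).hom ≫
        ((inv 𝒮[H] ≫ leftMul (counitLeft δ)) ≫ 𝒮[H] ≫ rightMul (counitLeft δ)) := by
      rw [hf]; simp
    _ = _ := by
      rw [← whisker_exchange_assoc]; monoidal

lemma IsDistinguished.unique [IsIso φ] {g g' : 𝟙_ S ⟶ H} (hg : IsDistinguished (φ ≫ ε[H]) g)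
    (hg' : IsDistinguished (φ ≫ ε[H]) g') : g' = g := by
  have e := congrArg (fun f => η[H] ≫ inv φ ≫ f) (hg'.symm.trans hg)
  simpa only [Category.assoc, IsIso.inv_hom_id_assoc, BimonObj.one_counit_assoc] using e

/-- The functional `φ ≫ ε` composed with the copairing recovers `φ` up to the antipode. -/
lemma copairing_functional (h : Pentagon γ₀ δ φ) :
    (λ_ H).inv ≫ γ₀ ▷ H ≫ (α_ H H H).hom ≫ H ◁ (μ[H] ≫ φ ≫ ε[H]) ≫ (ρ_ H).hom =
      φ ≫ inv 𝒮[H] := by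
  have e := congrArg (· ≫ H ◁ ε[H] ≫ (ρ_ H).hom) (pentagon_MYYY h)
  simp only [Category.assoc, MonoidalCategory.whiskerLeft_comp] at e
  simp only [MonoidalCategory.whiskerLeft_comp, Category.assoc, e]
  rw [← whisker_exchange_assoc, ComonObj.comul_counit_assoc]
  monoidal

lemma delta_functional (h : Pentagon γ₀ δ φ) :
    (λ_ H).inv ≫ δ ▷ H ≫ (α_ H H H).hom ≫ H ◁ (H ◁ φ ≫ μ[H] ≫ φ ≫ ε[H]) ≫ (ρ_ H).hom =
      𝟙 H := by
  have e := congrArg (· ≫ H ◁ ε[H] ≫ (ρ_ H).hom) (pentagon_XYZW h)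
  have hS : inv 𝒮[H] ≫ ε[H] = ε[H] := by rw [IsIso.inv_comp_eq, HopfObj.antipode_counit]
  simp only [Category.assoc] at e
  rw [← BraidedCategory.braiding_inv_naturality_left_assoc, braiding_inv_tensorUnit_right,
    ← comp_whiskerRight_assoc, hS, ComonObj.counit_comul_assoc] at e
  calc
    _ = 𝟙 _ ⊗≫ (δ ▷ H ≫ (H ⊗ H) ◁ φ) ⊗≫ H ◁ (μ[H] ≫ φ ≫ ε[H]) ⊗≫ 𝟙 _ := by monoidal
    _ = 𝟙 _ ⊗≫ φ ⊗≫ δ ▷ H ⊗≫ H ◁ (μ[H] ≫ φ ≫ ε[H]) ⊗≫ 𝟙 _ := by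
      rw [← whisker_exchange]; monoidal
    _ = φ ≫ (λ_ H).inv ≫ δ ▷ H ≫ (α_ H H H).hom ≫ H ◁ (μ[H] ≫ φ) ≫ H ◁ ε[H] ≫ (ρ_ H).hom := by
      monoidal
    _ = _ := by rw [e]; monoidal

lemma functional_isRightCointegral (h : Pentagon γ₀ δ φ) (hγ : HasMulInv γ₀) :
    IsRightCointegral (φ ≫ ε[H]) := by
  have e := congrArg (· ≫ ε[H] ▷ H ≫ (λ_ H).hom) (pentagon_XYZP h)
  simp only [Category.assoc] at e
  rw [IsRightCointegral, comp_whiskerRight, Category.assoc, ← e, Category.assoc]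
  refine congrArg (φ ≫ ·) ?_
  rw [← comp_whiskerRight_assoc, mul_counit_eq]
  calc
    _ = 𝟙 _ ⊗≫ (γ₀ ≫ ε[H] ▷ H) ▷ H ⊗≫ ((β_ H H).hom ≫ ε[H] ▷ H) ⊗≫ 𝟙 _ := by
      calc
        _ = 𝟙 _ ⊗≫ γ₀ ▷ H ⊗≫ (H ◁ (β_ H H).hom ≫ ε[H] ▷ (H ⊗ H)) ⊗≫ ε[H] ▷ H ⊗≫ 𝟙 _ := by
          monoidal
        _ = _ := by rw [whisker_exchange]; monoidal
    _ = 𝟙 _ ⊗≫ (γ₀ ≫ ε[H] ▷ H ≫ (λ_ H).hom) ▷ H ⊗≫ H ◁ ε[H] ⊗≫ 𝟙 _ := by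
      rw [← BraidedCategory.braiding_naturality_right, braiding_tensorUnit_right]; monoidal
    _ = 𝟙 _ ⊗≫ (η[H] ▷ H ≫ H ◁ ε[H]) ⊗≫ 𝟙 _ := by
      rw [show γ₀ ≫ ε[H] ▷ H ≫ (λ_ H).hom = η[H] from copairing_counit_left h hγ]; monoidal
    _ = _ := by
      rw [← whisker_exchange]; monoidal

end Distinguished

section DualHopf
variable {S : Type u} [Category.{v} S] [MonoidalCategory S] [BraidedCategory S]
  [RightRigidCategory S]
variable {H : S} [HopfObj H]

lemma coev_mate {X Y : S} (f : X ⟶ Y) : η_ Y (dual Y) ≫ Y ◁ fᘁ = η_ X (dual X) ≫ f ▷ dual X :=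
  coevaluation_comp_rightAdjointMate f

lemma isIso_mate {X : S} (f : X ⟶ X) [IsIso f] : IsIso (rightAdjointMate f) :=
  ⟨rightAdjointMate (inv f), by rw [← comp_rightAdjointMate, IsIso.inv_hom_id, rightAdjointMate_id],
    by rw [← comp_rightAdjointMate, IsIso.hom_inv_id, rightAdjointMate_id]⟩

lemma coev_capGamma (γ₀ : 𝟙_ S ⟶ H ⊗ H) :
    η_ H (dual H) ≫ H ◁ capGamma γ₀ = γ₀ ≫ H ◁ 𝒮[H] :=
  coev_capElem (γ₀ ≫ H ◁ 𝒮[H])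

lemma capGamma_eq (γ₀ : 𝟙_ S ⟶ H ⊗ H) : capGamma γ₀ = capElem γ₀ ≫ 𝒮[H] := by
  rw [capElem_comp]; rfl

variable [IsIso 𝒮[H]] {γ₀ δ : 𝟙_ S ⟶ H ⊗ H} {φ : H ⟶ H}

lemma gammaOf_capGamma (h : Pentagon γ₀ δ φ) (hγ : HasMulInv γ₀) :
    gammaOf (capGamma γ₀) = γ₀ := by
  rw [gammaOf, MonoidalCategory.tensorHom_def', reassoc_of% (coev_capGamma γ₀),
    ← reassoc_of% (copairing_antipode h hγ), ← comp_whiskerRight, IsIso.hom_inv_id]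
  simp

lemma deltaOf_capGamma (h : Pentagon γ₀ δ φ) (hγ : HasMulInv γ₀) :
    deltaOf (capGamma γ₀) (counitLeft δ) = δ := by
  conv_rhs => rw [delta_eq h hγ]
  rw [deltaOf, MonoidalCategory.tensorHom_def', MonoidalCategory.whiskerLeft_comp, Category.assoc,
    reassoc_of% (coev_capGamma γ₀), ← whisker_exchange, MonoidalCategory.whiskerLeft_comp,
    Category.assoc]

lemma phiOf_capGamma (h : Pentagon γ₀ δ φ) (hγ : HasMulInv γ₀) :
    phiOf (capGamma γ₀) (φ ≫ ε[H]) = φ := by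
  rw [phiOf, coev_capGamma, ← copairing_antipode h hγ]
  calc
    _ = 𝟙 _ ⊗≫ γ₀ ▷ H ⊗≫ (𝒮[H] ▷ (H ⊗ H) ≫ H ◁ (μ[H] ≫ φ ≫ ε[H])) ⊗≫ 𝟙 _ := by monoidal
    _ = ((λ_ H).inv ≫ γ₀ ▷ H ≫ (α_ H H H).hom ≫ H ◁ (μ[H] ≫ φ ≫ ε[H]) ≫ (ρ_ H).hom) ≫ 𝒮[H] := by
      rw [← whisker_exchange]; monoidal
    _ = _ := by
      rw [copairing_functional h]; simp

lemma capElem_delta (h : Pentagon γ₀ δ φ) (hγ : HasMulInv γ₀) :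
    capElem δ = rightAdjointMate 𝒮[H] ≫ capGamma γ₀ ≫ rightMul (counitLeft δ) := by
  apply dual_hom_ext
  rw [coev_capElem, MonoidalCategory.whiskerLeft_comp, reassoc_of% (coev_mate 𝒮[H])]
  conv_lhs => rw [← deltaOf_capGamma h hγ, deltaOf, MonoidalCategory.tensorHom_def]

lemma capGamma_isIso (h : Pentagon γ₀ δ φ) (hγ : HasMulInv γ₀) : IsIso (capGamma γ₀) := by
  have hp := delta_functional h
  set p := H ◁ φ ≫ μ[H] ≫ φ ≫ ε[H] with hp_def
  have : IsIso (rightAdjointMate 𝒮[H]) := isIso_mate _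
  have hmono : IsSplitMono (capGamma γ₀) := by
    obtain ⟨r, hr⟩ := capElem_retract δ p hp
    rw [capElem_delta h hγ] at hr
    refine ⟨⟨rightMul (counitLeft δ) ≫ r ≫ rightAdjointMate 𝒮[H], ?_⟩⟩
    rw [← cancel_epi (rightAdjointMate 𝒮[H])]
    simp only [Category.assoc] at hr
    rw [reassoc_of% hr, Category.comp_id]
  have hepi : IsSplitEpi (capGamma γ₀) := by
    have hδ : δ = (γ₀ ≫ leftMul (counitLeft δ) ▷ H) ≫ (β_ H H).inv := by
      rw [Iso.eq_comp_inv]; exact pentagon_XNYP_counit h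
    have hq := elem_pull (γ₀ ≫ leftMul (counitLeft δ) ▷ H) p
    rw [← hδ, hp] at hq
    obtain ⟨s, hs⟩ : ∃ s, s ≫ capElem γ₀ = 𝟙 H := by
      refine ⟨_, (capElem_section γ₀
        (H ◁ leftMul (counitLeft δ) ≫ (β_ H H).inv ≫ p)).trans (Eq.trans ?_ hq)⟩
      monoidal
    refine ⟨⟨inv 𝒮[H] ≫ s, ?_⟩⟩
    rw [capGamma_eq, Category.assoc, reassoc_of% hs, IsIso.inv_hom_id]
  exact isIso_of_epi_of_isSplitMono _

lemma capGamma_map_one (h : Pentagon γ₀ δ φ) (hγ : HasMulInv γ₀) :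
    dualOne H ≫ capGamma γ₀ = η[H] := by
  calc
    _ = 𝟙 _ ⊗≫ η_ H (dual H) ⊗≫ (ε[H] ▷ dual H ≫ 𝟙_ S ◁ capGamma γ₀) ⊗≫ 𝟙 _ := by
      rw [dualOne]; monoidal
    _ = (η_ H (dual H) ≫ H ◁ capGamma γ₀) ⊗≫ ε[H] ▷ H ⊗≫ 𝟙 _ := by
      rw [← whisker_exchange]; monoidal
    _ = 𝟙 _ ⊗≫ γ₀ ⊗≫ (H ◁ 𝒮[H] ≫ ε[H] ▷ H) ⊗≫ 𝟙 _ := by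
      rw [coev_capGamma]; monoidal
    _ = counitLeft γ₀ ≫ 𝒮[H] := by
      rw [whisker_exchange, counitLeft]; monoidal
    _ = _ := by
      rw [copairing_counit_left h hγ, HopfObj.one_antipode]

lemma capGamma_map_counit (h : Pentagon γ₀ δ φ) (hγ : HasMulInv γ₀) :
    capGamma γ₀ ≫ ε[H] = dualCounit H := by
  have e : γ₀ ≫ H ◁ ε[H] = η[H] ≫ (ρ_ H).inv := by
    rw [← copairing_counit_right h hγ]; simp
  rw [capGamma_eq, Category.assoc, HopfObj.antipode_counit, capElem_comp, e, capElem, dualCounit]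
  monoidal

lemma capGamma_map_antipode (h : Pentagon γ₀ δ φ) (hγ : HasMulInv γ₀) :
    dualAntipode H ≫ capGamma γ₀ = capGamma γ₀ ≫ 𝒮[H] := by
  apply dual_hom_ext
  rw [dualAntipode, MonoidalCategory.whiskerLeft_comp, reassoc_of% (coev_mate 𝒮[H]),
    MonoidalCategory.whiskerLeft_comp, reassoc_of% (coev_capGamma γ₀), ← whisker_exchange,
    reassoc_of% (coev_capGamma γ₀), whisker_exchange, reassoc_of% (copairing_antipode h hγ)]

end DualHopf

section Normalisation
variable {S : Type u} [Category.{v} S] [MonoidalCategory S] [BraidedCategory S]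
variable {H : S} [HopfObj H] [IsIso 𝒮[H]] {γ₀ δ : 𝟙_ S ⟶ H ⊗ H} {φ : H ⟶ H}

lemma copairing_functional_elem (h : Pentagon γ₀ δ φ) (x : 𝟙_ S ⟶ H) :
    γ₀ ≫ H ◁ (rightMul x ≫ φ ≫ ε[H]) ≫ (ρ_ H).hom = x ≫ φ ≫ inv 𝒮[H] := by
  rw [← copairing_functional h, rightMul]
  calc
    _ = 𝟙 _ ⊗≫ (γ₀ ▷ 𝟙_ S ≫ (H ⊗ H) ◁ x) ⊗≫ H ◁ (μ[H] ≫ φ ≫ ε[H]) ⊗≫ 𝟙 _ := by monoidal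
    _ = _ := by rw [← whisker_exchange]; monoidal

lemma phi_leftMul_phi (h : Pentagon γ₀ δ φ) :
    φ ≫ leftMul (counitLeft δ) ≫ φ = inv 𝒮[H] := by
  have e := congrArg (· ≫ ε[H] ▷ H ≫ (λ_ H).hom) (pentagon_XYZW h)
  simp only [Category.assoc] at e
  rw [← BraidedCategory.braiding_inv_naturality_right_assoc, braiding_inv_tensorUnit_left,
    ← whisker_exchange_assoc, ComonObj.comul_counit_assoc] at e
  calc
    _ = φ ≫ ((λ_ H).inv ≫ (counitLeft δ) ▷ H ≫ μ[H]) ≫ φ := by rw [leftMul]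
    _ = φ ⊗≫ δ ▷ H ⊗≫ (ε[H] ▷ (H ⊗ H) ≫ 𝟙_ S ◁ (μ[H] ≫ φ)) ⊗≫ 𝟙 _ := by
      rw [counitLeft]; monoidal
    _ = φ ≫ (λ_ H).inv ≫ δ ▷ H ≫ (α_ H H H).hom ≫ H ◁ (μ[H] ≫ φ) ≫ ε[H] ▷ H ≫ (λ_ H).hom := by
      rw [← whisker_exchange]; monoidal
    _ = _ := by rw [e]; monoidal

lemma one_phi_leftMul [IsIso φ] (h : Pentagon γ₀ δ φ) :
    η[H] ≫ φ ≫ leftMul (counitLeft δ) = η[H] ≫ φ := by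
  set d := counitLeft δ with hd
  set x : 𝟙_ S ⟶ H := d ≫ 𝒮[H] ≫ inv φ with hx
  set Ψ : H ⟶ 𝟙_ S := rightMul x ≫ φ ≫ ε[H] with hΨ
  have h1 : γ₀ ≫ H ◁ Ψ ≫ (ρ_ H).hom = d := by
    rw [hΨ, copairing_functional_elem h, hx]; simp
  have h2 : η[H] ≫ Ψ = 𝟙 _ := by
    rw [hΨ, reassoc_of% (one_rightMul x), hx]
    simp only [Category.assoc, IsIso.inv_hom_id_assoc, HopfObj.antipode_counit]
    exact counitLeft_delta_counit h
  have e := congrArg (fun f => η[H] ≫ f ≫ H ◁ Ψ ≫ (ρ_ H).hom) (pentagon_XYZP h)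
  simp only [Category.assoc] at e
  calc
    _ = η[H] ≫ φ ⊗≫ (γ₀ ≫ H ◁ Ψ ≫ (ρ_ H).hom) ▷ H ⊗≫ μ[H] := by
      rw [h1, leftMul]; monoidal
    _ = η[H] ≫ φ ⊗≫ γ₀ ▷ H ⊗≫ H ◁ (Ψ ▷ H ≫ (β_ (𝟙_ S) H).hom) ⊗≫ μ[H] := by
      rw [braiding_tensorUnit_left]; monoidal
    _ = η[H] ≫ φ ⊗≫ γ₀ ▷ H ⊗≫ H ◁ (β_ H H).hom ⊗≫ ((H ⊗ H) ◁ Ψ ≫ μ[H] ▷ 𝟙_ S) ⊗≫ 𝟙 _ := by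
      rw [BraidedCategory.braiding_naturality_left]; monoidal
    _ = η[H] ≫ φ ≫ (λ_ H).inv ≫ γ₀ ▷ H ≫ (α_ H H H).hom ≫ H ◁ (β_ H H).hom ≫
          (α_ H H H).inv ≫ μ[H] ▷ H ≫ H ◁ Ψ ≫ (ρ_ H).hom := by
      rw [whisker_exchange]; monoidal
    _ = η[H] ≫ Δ[H] ≫ φ ▷ H ≫ H ◁ Ψ ≫ (ρ_ H).hom := e
    _ = (λ_ (𝟙_ S)).inv ≫ (η[H] ≫ φ) ▷ 𝟙_ S ≫ H ◁ (η[H] ≫ Ψ) ≫ (ρ_ H).hom := by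
      rw [← Category.assoc, BimonObj.one_comul, MonObj.tensorObj.one_def,
        MonoidalCategory.tensorHom_def]
      simp only [Category.assoc, MonoidalCategory.whiskerLeft_comp, comp_whiskerRight]
      rw [whisker_exchange_assoc]
    _ = _ := by
      rw [h2]; monoidal

lemma copairing_normalised [IsIso φ] (h : Pentagon γ₀ δ φ) (hγ : HasMulInv γ₀) :
    γ₀ ≫ H ◁ 𝒮[H] ≫ ((φ ≫ ε[H]) ⊗ₘ (φ ≫ ε[H])) ≫ (λ_ (𝟙_ S)).hom = 𝟙 (𝟙_ S) := by
  have e1 : γ₀ ≫ H ◁ (φ ≫ ε[H]) ≫ (ρ_ H).hom = η[H] ≫ φ ≫ inv 𝒮[H] := by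
    have := copairing_functional_elem h η[H]
    rwa [rightMul_one, Category.id_comp] at this
  calc
    _ = (γ₀ ≫ H ◁ (φ ≫ ε[H]) ≫ (ρ_ H).hom) ≫ 𝒮[H] ≫ φ ≫ ε[H] := by
      rw [← reassoc_of% (copairing_antipode h hγ), MonoidalCategory.tensorHom_def',
        Category.assoc, ← whisker_exchange_assoc]
      monoidal
    _ = (η[H] ≫ φ ≫ leftMul (counitLeft δ)) ≫ φ ≫ ε[H] := by
      rw [e1, one_phi_leftMul h]; simp
    _ = η[H] ≫ (φ ≫ leftMul (counitLeft δ) ≫ φ) ≫ ε[H] := by simp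
    _ = _ := by
      have hS : inv 𝒮[H] ≫ ε[H] = ε[H] := by rw [IsIso.inv_comp_eq, HopfObj.antipode_counit]
      rw [phi_leftMul_phi h, hS, BimonObj.one_counit]

lemma copairing_braiding [IsIso φ] (h : Pentagon γ₀ δ φ) (hγ : HasMulInv γ₀) :
    γ₀ ≫ H ◁ (𝒮[H] ≫ adConj (counitLeft δ ≫ 𝒮[H]) (counitLeft δ) ≫ 𝒮[H] ≫ 𝒮[H]) ≫
      (β_ H H).hom = γ₀ ≫ H ◁ 𝒮[H] := by
  set d := counitLeft δ with hd
  have hU : leftMul d ≫ leftMul (d ≫ 𝒮[H]) = 𝟙 H := by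
    rw [leftMul_comp, show elemMul (d ≫ 𝒮[H]) d = η[H] from
      (counitLeft_delta_isGroupLike h).isMulInv.2, leftMul_one]
  have hE : δ ≫ (β_ H H).hom = γ₀ ≫ leftMul d ▷ H := pentagon_XNYP_counit h
  set U := leftMul (d ≫ 𝒮[H]) ≫ 𝒮[H] ≫ 𝒮[H] with hUdef
  calc
    _ = (γ₀ ≫ H ◁ (𝒮[H] ≫ rightMul d)) ≫ H ◁ U ≫ (β_ H H).hom := by
      rw [adConj]; simp [hUdef]
    _ = (δ ≫ (β_ H H).hom) ≫ U ▷ H ≫ H ◁ inv 𝒮[H] := by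
      rw [← delta_antipode h hγ, BraidedCategory.braiding_naturality_right, Category.assoc,
        BraidedCategory.braiding_naturality_left_assoc, Category.assoc, whisker_exchange]
    _ = γ₀ ≫ ((leftMul d ≫ leftMul (d ≫ 𝒮[H])) ≫ 𝒮[H] ≫ 𝒮[H]) ▷ H ≫ H ◁ inv 𝒮[H] := by
      rw [hE, hUdef]; simp
    _ = (γ₀ ≫ 𝒮[H] ▷ H) ≫ 𝒮[H] ▷ H ≫ H ◁ inv 𝒮[H] := by
      rw [hU]; simp
    _ = (γ₀ ≫ 𝒮[H] ▷ H) ≫ H ◁ (𝒮[H] ≫ inv 𝒮[H]) := by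
      rw [copairing_antipode h hγ, Category.assoc, whisker_exchange_assoc,
        reassoc_of% (copairing_antipode h hγ)]
      simp
    _ = _ := by
      rw [copairing_antipode h hγ]; simp

end Normalisation

section SelfDual
variable {S : Type u} [Category.{v} S] [MonoidalCategory S] [BraidedCategory S]
  [RightRigidCategory S] [RibbonCategory S]
variable {H : S} [HopfObj H] [IsIso 𝒮[H]] {γ₀ δ : 𝟙_ S ⟶ H ⊗ H} {φ : H ⟶ H} [IsIso φ]

lemma capGamma_mate (h : Pentagon γ₀ δ φ) (hγ : HasMulInv γ₀) :
    rightAdjointMate (capGamma γ₀) =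
      capGamma γ₀ ≫ adConj (counitLeft δ ≫ 𝒮[H]) (counitLeft δ) ≫ 𝒮[H] ≫ 𝒮[H] ≫
        (RibbonCategory.twist (S := S)).inv.app H ≫ toDoubleDual H := by
  have ht : (RibbonCategory.twist (S := S)).inv.app H ≫ toDoubleDual H = drinfeld H := by
    rw [toDoubleDual, Iso.inv_hom_id_app_assoc]
  have hz := capElem_braiding_ev (γ₀ ≫ H ◁ (𝒮[H] ≫
    adConj (counitLeft δ ≫ 𝒮[H]) (counitLeft δ) ≫ 𝒮[H] ≫ 𝒮[H]))
  rw [Category.assoc, copairing_braiding h hγ] at hz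
  apply hom_dual_ext
  rw [rightAdjointMate_comp_evaluation, ht, capGamma_eq]
  have e : (capElem γ₀ ≫ 𝒮[H]) ≫ adConj (counitLeft δ ≫ 𝒮[H]) (counitLeft δ) ≫ 𝒮[H] ≫
      𝒮[H] ≫ drinfeld H = capElem (γ₀ ≫ H ◁ (𝒮[H] ≫
    adConj (counitLeft δ ≫ 𝒮[H]) (counitLeft δ) ≫ 𝒮[H] ≫ 𝒮[H])) ≫ drinfeld H := by
    rw [← capElem_comp]; simp
  rw [e, comp_whiskerRight, Category.assoc, drinfeld_ev, hz, capElem_comp]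

end SelfDual

section NestedCopairing
variable {S : Type u} [Category.{v} S] [MonoidalCategory S]

/-- The element of `(X ⊗ X) ⊗ (Y ⊗ Y)` given by two nested copies of an element of `X ⊗ Y`. -/
def nest {X Y : S} (x : 𝟙_ S ⟶ X ⊗ Y) : 𝟙_ S ⟶ (X ⊗ X) ⊗ (Y ⊗ Y) :=
  x ≫ X ◁ ((λ_ Y).inv ≫ x ▷ Y ≫ (α_ X Y Y).hom) ≫ (α_ X X (Y ⊗ Y)).inv

lemma nest_comp {X Y Z : S} (x : 𝟙_ S ⟶ X ⊗ Y) (f : Y ⟶ Z) :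
    nest x ≫ (X ⊗ X) ◁ (f ⊗ₘ f) = nest (x ≫ X ◁ f) := by
  rw [nest, nest, MonoidalCategory.tensorHom_def]
  calc
    _ = 𝟙 _ ⊗≫ x ⊗≫ X ◁ ((x ≫ X ◁ f) ▷ Y ≫ (X ⊗ Z) ◁ f) ⊗≫ 𝟙 _ := by monoidal
    _ = _ := by rw [← whisker_exchange]; monoidal

lemma tensorμ_braiding_eq_nest [BraidedCategory S] {X Y : S} (x : 𝟙_ S ⟶ X ⊗ Y) :
    (λ_ (𝟙_ S)).inv ≫ (x ⊗ₘ x) ≫ tensorμ X Y X Y ≫ (X ⊗ X) ◁ (β_ Y Y).hom = nest x := by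
  calc
    _ = 𝟙 _ ⊗≫ x ⊗≫ X ◁ (Y ◁ x ≫ (β_ Y (X ⊗ Y)).hom) ⊗≫ 𝟙 _ := by
      rw [tensorμ, MonoidalCategory.tensorHom_def, BraidedCategory.braiding_tensor_right_hom]
      monoidal
    _ = _ := by
      rw [BraidedCategory.braiding_naturality_right, braiding_tensorUnit_right, nest]; monoidal

variable [BraidedCategory S] [RightRigidCategory S]

/-- The morphism `Xᘁ ⊗ Xᘁ ⟶ Y` given by an element of `(X ⊗ X) ⊗ Y`. -/
def capPair {X Y : S} (y : 𝟙_ S ⟶ (X ⊗ X) ⊗ Y) : dual X ⊗ dual X ⟶ Y :=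
  (ρ_ (dual X ⊗ dual X)).inv ≫ (dual X ⊗ dual X) ◁ y ≫
    (α_ (dual X ⊗ dual X) (X ⊗ X) Y).inv ≫ dualPair X ▷ Y ≫ (λ_ Y).hom

lemma capPair_comp {X Y Z : S} (y : 𝟙_ S ⟶ (X ⊗ X) ⊗ Y) (f : Y ⟶ Z) :
    capPair y ≫ f = capPair (y ≫ (X ⊗ X) ◁ f) := by
  calc
    _ = 𝟙 _ ⊗≫ (dual X ⊗ dual X) ◁ y ⊗≫ (dualPair X ▷ Y ≫ 𝟙_ S ◁ f) ⊗≫ 𝟙 _ := by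
      rw [capPair]; monoidal
    _ = _ := by rw [← whisker_exchange, capPair]; monoidal

lemma capPair_nest {X Y : S} (x : 𝟙_ S ⟶ X ⊗ Y) :
    capPair (nest x) = capElem x ⊗ₘ capElem x := by
  rw [MonoidalCategory.tensorHom_def']
  calc
    _ = 𝟙 _ ⊗≫ (dual X ⊗ dual X) ◁ x ⊗≫ dual X ◁ ((dual X ⊗ X) ◁ (x ▷ Y) ≫
          ε_ X (dual X) ▷ ((X ⊗ Y) ⊗ Y)) ⊗≫ ε_ X (dual X) ▷ (Y ⊗ Y) ⊗≫ 𝟙 _ := by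
      rw [capPair, nest, dualPair]; monoidal
    _ = _ := by rw [whisker_exchange, capElem]; monoidal

variable {H : S} [HopfObj H] [IsIso 𝒮[H]] {γ₀ δ : 𝟙_ S ⟶ H ⊗ H} {φ : H ⟶ H}

lemma capGamma_map_comul (h : Pentagon γ₀ δ φ) :
    capGamma γ₀ ≫ Δ[H] = dualComul H ≫ (capGamma γ₀ ⊗ₘ capGamma γ₀) := by
  have hD : η_ H (dual H) ≫ H ◁ dualComul H =
      nest (η_ H (dual H)) ≫ μ[H] ▷ (dual H ⊗ dual H) :=
    coev_capElem _
  apply dual_hom_ext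
  calc
    _ = (γ₀ ≫ H ◁ Δ[H]) ≫ H ◁ ((β_ H H).hom ≫ (𝒮[H] ⊗ₘ 𝒮[H])) := by
      rw [MonoidalCategory.whiskerLeft_comp, reassoc_of% (coev_capGamma γ₀),
        ← MonoidalCategory.whiskerLeft_comp, HopfObj.antipode_comul]
      simp
    _ = ((λ_ (𝟙_ S)).inv ≫ (γ₀ ⊗ₘ γ₀) ≫ tensorμ H H H H ≫ (H ⊗ H) ◁ (β_ H H).hom) ≫
          (H ⊗ H) ◁ (𝒮[H] ⊗ₘ 𝒮[H]) ≫ μ[H] ▷ (H ⊗ H) := by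
      rw [pentagon_MYNP h]
      simp only [Category.assoc]
      rw [← whisker_exchange, MonoidalCategory.whiskerLeft_comp, Category.assoc]
    _ = nest (η_ H (dual H)) ≫ (H ⊗ H) ◁ (capGamma γ₀ ⊗ₘ capGamma γ₀) ≫ μ[H] ▷ (H ⊗ H) := by
      rw [tensorμ_braiding_eq_nest, reassoc_of% (nest_comp γ₀ 𝒮[H]), ← coev_capGamma,
        ← nest_comp, Category.assoc]
    _ = _ := by
      rw [whisker_exchange, MonoidalCategory.whiskerLeft_comp, reassoc_of% hD]

lemma capGamma_map_mul (h : Pentagon γ₀ δ φ) :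
    dualMul H ≫ capGamma γ₀ = (capGamma γ₀ ⊗ₘ capGamma γ₀) ≫ μ[H] := by
  have hM : dualMul H = capPair (η_ H (dual H) ≫ Δ[H] ▷ dual H) := rfl
  have hΓ : capGamma γ₀ = capElem (γ₀ ≫ H ◁ 𝒮[H]) := rfl
  rw [hM, capPair_comp, Category.assoc, ← whisker_exchange, reassoc_of% (coev_capGamma γ₀), hΓ,
    ← capPair_nest, capPair_comp, ← nest_comp, ← tensorμ_braiding_eq_nest]
  congr 1
  calc
    _ = (γ₀ ≫ Δ[H] ▷ H) ≫ (H ⊗ H) ◁ 𝒮[H] := by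
      rw [whisker_exchange, Category.assoc]
    _ = _ := by
      rw [pentagon_MNYP h]
      simp only [Category.assoc, ← MonoidalCategory.whiskerLeft_comp]
      rw [HopfObj.mul_antipode, BraidedCategory.braiding_naturality_assoc]

end NestedCopairing

end HopfExt

theorem proposition3p1 {S : Type u} [Category.{v} S] [MonoidalCategory S] [BraidedCategory S]
    [RightRigidCategory S] [RibbonCategory S]
    (H : S) [HopfObj H] [IsIso 𝒮[H]]
    (γ₀ δ : 𝟙_ S ⟶ H ⊗ H) (φ : H ⟶ H)
    (hγ : HasMulInv γ₀) (hδ : HasMulInv (δ ≫ inv 𝒮[H] ▷ H)) (hφ : IsIso φ)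
    (hpent : Pentagon γ₀ δ φ)
    (Γ : dual H ⟶ H) (hΓ : Γ = capGamma γ₀) (lam : H ⟶ 𝟙_ S) (hlam : lam = φ ≫ ε[H]) :
    -- `g` exists, is determined by `lam`, is group-like and has a multiplicative inverse
    ∃ g gInv : 𝟙_ S ⟶ H,
      (IsDistinguished lam g ∧ (∀ g', IsDistinguished lam g' → g' = g) ∧
        IsMulInv g gInv ∧ IsGroupLike g) ∧
      -- the formulas for the three morphisms of the ansatz
      (γ₀ = gammaOf Γ ∧ δ = deltaOf Γ g ∧ φ = phiOf Γ lam) ∧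
      -- `Γ` is an isomorphism of Hopf algebras
      IsDualHopfIso Γ ∧
      -- `lam` is a normalised right cointegral
      (IsRightCointegral lam ∧
        η_ H (dual H) ≫ H ◁ Γ ≫ (lam ⊗ₘ lam) ≫ (λ_ (𝟙_ S)).hom = 𝟙 (𝟙_ S)) ∧
      -- `Γ` is self-dual up to a twist
      Γᘁ = Γ ≫ adConj gInv g ≫ 𝒮[H] ≫ 𝒮[H] ≫
        (RibbonCategory.twist (S := S)).inv.app H ≫ toDoubleDual H := by
  subst hΓ hlam
  refine ⟨counitLeft δ, counitLeft δ ≫ 𝒮[H], ⟨counitLeft_delta_isDistinguished hpent,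
    fun g' hg' => (counitLeft_delta_isDistinguished hpent).unique hg',
    (counitLeft_delta_isGroupLike hpent).isMulInv, counitLeft_delta_isGroupLike hpent⟩,
    ⟨(gammaOf_capGamma hpent hγ).symm, (deltaOf_capGamma hpent hγ).symm,
      (phiOf_capGamma hpent hγ).symm⟩,
    ⟨capGamma_isIso hpent hγ, capGamma_map_mul hpent, capGamma_map_one hpent hγ,
      capGamma_map_comul hpent, capGamma_map_counit hpent hγ, capGamma_map_antipode hpent hγ⟩,
    ⟨functional_isRightCointegral hpent hγ, ?_⟩, capGamma_mate hpent hγ⟩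
  rw [reassoc_of% (coev_capGamma γ₀)]
  exact copairing_normalised hpent hγ
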